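/- Let $\mathcal K^2$ be the family of nonempty compact convex subsets of $\mathbb R^2$ with the Hausdorff metric. For $K\in\mathcal K^2$ with nonempty interior, let $n(s)$ be the outer unit normal at $s\in\partial K$, which is unique for almost every $s$ with respect to the arc length $\sigma_K$ on $\partial K$. Let $n'(s)$ be $n(s)$ rotated counterclockwise by $\pi/2$. For nonnegative integers $p,q$ put $$\psi_{p,q}(K)=\int_{\partial K}\langle s,n(s)\rangle^p\,\langle s,n'(s)\rangle^q\,d\sigma_K(s),$$ with $0^0=1$. If $K$ is a nondegenerate segment, the integral is taken over both sides of $K$: for almost every $s\in K$ the integrand is summed over the two unit normals of $K$. If $K$ is a point, $\psi_{p,q}(K)=0$. A function $\varphi:\mathcal K^2\to\mathbb R$ is a valuation if $\varphi(K_1\cup K_2)+\varphi(K_1\cap K_2)=\varphi(K_1)+\varphi(K_2)$ whenever $K_1,K_2,K_1\cup K_2\in\mathcal K^2$. It is polynomial of degree at most $\ell$ if for each $K\in\mathcal K^2$ the function $x\mapsto\varphi(K+x)$ is a polynomial on $\mathbb R^2$ of degree at most $\ell$. Its degree of polynomiality is the least such $\ell\ge 0$ (so degree $0$ means translation invariant).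 Proposition 4.3. For all nonnegative integers $p,q$ the integral defining $\psi_{p,q}(K)$ converges absolutely for every $K\in\mathcal K^2$, and $\psi_{p,q}$ is a continuous $\mathrm{SO}(2)$-invariant polynomial valuation. Its degree of polynomiality is $p+q$ if $p+q\neq1$, and $0$ if $p+q=1$. Moreover, $\psi_{p,q}$ is $\mathrm{O}(2)$-invariant if and only if $q$ is even or $(p,q)=(0,1)$. -/

import Mathlib

open MeasureTheory

noncomputable section

/-- `ℝᵈ` with its Euclidean norm and inner product. -/
abbrev Euc (d : ℕ) : Type := EuclideanSpace ℝ (Fin d)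

/-- The translate `K + x` of a nonempty compact convex set. -/
def translateBody {d : ℕ} (K : ConvexBody (Euc d)) (x : Euc d) : ConvexBody (Euc d) where
  carrier := (fun y => y + x) '' (K : Set (Euc d))
  convex' := by
    simpa only [add_comm] using K.convex.translate x
  isCompact' := K.isCompact.image (by fun_prop)
  nonempty' := K.nonempty.image _

/-- The image `U K` of a nonempty compact convex set under a linear isometry `U ∈ O(d)`. -/
def rotateBody {d : ℕ} (U : Euc d ≃ₗᵢ[ℝ] Euc d) (K : ConvexBody (Euc d)) :
    ConvexBody (Euc d) where
  carrier := U '' (K : Set (Euc d))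
  convex' := K.convex.linear_image U.toLinearEquiv.toLinearMap
  isCompact' := K.isCompact.image U.continuous
  nonempty' := K.nonempty.image _

/-- `φ(K₁ ∪ K₂) + φ(K₁ ∩ K₂) = φ(K₁) + φ(K₂)` whenever `K₁ ∪ K₂` is convex. (For nonempty compact
convex `K₁`, `K₂` with convex union the intersection is nonempty, by connectedness; so the body `M`
below exists as soon as `L` does.) -/
def IsValuation {d : ℕ} (φ : ConvexBody (Euc d) → ℝ) : Prop :=
  ∀ K₁ K₂ L M : ConvexBody (Euc d),
    (L : Set (Euc d)) = (K₁ : Set (Euc d)) ∪ (K₂ : Set (Euc d)) →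
    (M : Set (Euc d)) = (K₁ : Set (Euc d)) ∩ (K₂ : Set (Euc d)) →
    φ L + φ M = φ K₁ + φ K₂

/-- For each `K`, the function `x ↦ φ(K + x)` is a polynomial in the coordinates of `x`, of total
degree at most `ℓ`. -/
def IsPolynomialOfDegreeLE {d : ℕ} (φ : ConvexBody (Euc d) → ℝ) (ℓ : ℕ) : Prop :=
  ∀ K : ConvexBody (Euc d), ∃ P : MvPolynomial (Fin d) ℝ, P.totalDegree ≤ ℓ ∧
    ∀ x : Euc d, φ (translateBody K x) = MvPolynomial.eval (fun i => x i) P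

/-- The degree of polynomiality is `ℓ`: the least `ℓ` such that `φ` is polynomial of degree at
most `ℓ`. Degree `0` means translation invariant (the zero function included). -/
def HasPolynomialDegree {d : ℕ} (φ : ConvexBody (Euc d) → ℝ) (ℓ : ℕ) : Prop :=
  IsLeast {m : ℕ | IsPolynomialOfDegreeLE φ m} ℓ

/-- Invariance under all linear isometries. -/
def IsOInvariant {d : ℕ} (φ : ConvexBody (Euc d) → ℝ) : Prop :=
  ∀ (U : Euc d ≃ₗᵢ[ℝ] Euc d) (K : ConvexBody (Euc d)), φ (rotateBody U K) = φ K

/-- Invariance under all linear isometries of determinant `1`. -/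
def IsSOInvariant {d : ℕ} (φ : ConvexBody (Euc d) → ℝ) : Prop :=
  ∀ U : Euc d ≃ₗᵢ[ℝ] Euc d, LinearMap.det (U.toLinearEquiv : Euc d →ₗ[ℝ] Euc d) = 1 →
    ∀ K : ConvexBody (Euc d), φ (rotateBody U K) = φ K

/-- The outer unit normal vectors of `K` at the point `s`. -/
def outerUnitNormals {d : ℕ} (K : ConvexBody (Euc d)) (s : Euc d) : Set (Euc d) :=
  {n | ‖n‖ = 1 ∧ ∀ y ∈ K, inner ℝ (y - s) n ≤ 0}

/-- Counterclockwise rotation of the plane by `π / 2`. -/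
def quarterTurn (n : Euc 2) : Euc 2 := !₂[-n 1, n 0]

/-- The integrand `⟨s, n⟩ᵖ ⟨s, n'⟩^q` at the boundary point `s`, summed over the outer unit normals
`n` of `K` at `s`, where `n'` is `n` turned by `π / 2`.

If `K` has nonempty interior, then almost every `s ∈ ∂K` has exactly one outer unit normal `n(s)`,
and the sum has one term. If `K` is a segment, then each relative interior point of `K` has exactly
two outer unit normals `±n`, so that the segment is counted from both sides, in accordance with
its surface area measure. The points with infinitely many normals (vertices, endpoints) are
countable in number and do not contribute to the integral; `finsum` gives them the value `0`
unless only finitely many of the terms are nonzero. -/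
def psiIntegrand (p q : ℕ) (K : ConvexBody (Euc 2)) (s : Euc 2) : ℝ :=
  ∑ᶠ n ∈ outerUnitNormals K s, inner ℝ s n ^ p * inner ℝ s (quarterTurn n) ^ q

/-- `ψ_{p,q}(K) = ∫_{∂K} ⟨s, n(s)⟩ᵖ ⟨s, n'(s)⟩^q dσ_K(s)`, with respect to arc length
(one-dimensional Hausdorff measure) on `∂K`. It is `0` if `K` is a point. -/
def psi (p q : ℕ) (K : ConvexBody (Euc 2)) : ℝ :=
  ∫ s in frontier (K : Set (Euc 2)), psiIntegrand p q K s ∂μH[1]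

end

noncomputable section

open Set Filter Topology

/-! Everything is done for a general continuous kernel F: `boundaryIntegral F K` integrates over K,
with respect to one-dimensional Hausdorff measure, the sum of F(s, n) over the outer unit normals n
at s. Interior points have no normals, so this is an integral over ∂K. Points with two normals that
are neither equal nor opposite form a countable, hence null, set; elsewhere the sum has at most two
terms.

Integrability and continuity come from a reduction to the line. For a unit vector u, the part of the
boundary with a normal n satisfying ⟨u, n⟩ > 0 is, up to a countable set, a graph over the line
orthogonal to u, and the projection to that line has Jacobian ⟨u, n⟩
(`IsSupportedGraph.lintegral_inner_eq`). For a unit vector n, the squared positive parts of ⟨e, n⟩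
over the four axis directions e add up to 1. Hence `boundaryIntegral F` is a sum of four Lebesgue
integrals of functions `slice`, bounded and zero outside a bounded interval
(`boundaryIntegral_eq_sum_slice`). If bodies converge, these functions converge almost everywhere,
and dominated convergence applies.

The valuation property is inclusion-exclusion under the integral: at common points of K₁ and K₂, the
normals of the union and of the intersection are the intersection and the union of the two sets of
normals. An orthogonal map U multiplies ψ by (det U)^q, because it commutes with the quarter turn up
to the factor det U.

Polynomiality follows by expanding the kernel at s + x and integrating the coefficients. Along a
line, the coefficient of t^(p+q) in ψ(K + tx) is the integral of ⟨x, n⟩^p ⟨x, n'⟩^q, which is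
nonzero for a suitable x and a right triangle with legs 1 and 2 once p + q ≥ 2. If p + q = 1, it
vanishes because the normals integrate to 0. The function ψ with (p, q) = (0, 1) is identically
zero, since projections from opposite sides cancel (`boundaryIntegral_inner_eq_zero`). -/

lemma inner_euc_two (x y : Euc 2) : inner ℝ x y = x 0 * y 0 + x 1 * y 1 := by
  simp [PiLp.inner_apply, Fin.sum_univ_two]; ring

lemma norm_sq_euc_two (x : Euc 2) : ‖x‖ ^ 2 = x 0 ^ 2 + x 1 ^ 2 := by
  rw [← real_inner_self_eq_norm_sq, inner_euc_two]; ring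

lemma norm_euc_two_eq_one_iff (x : Euc 2) : ‖x‖ = 1 ↔ x 0 ^ 2 + x 1 ^ 2 = 1 := by
  rw [← norm_sq_euc_two, pow_eq_one_iff_of_nonneg (norm_nonneg x) two_ne_zero]

@[simp] lemma quarterTurn_zero (x : Euc 2) : quarterTurn x 0 = -x 1 := rfl

@[simp] lemma quarterTurn_one (x : Euc 2) : quarterTurn x 1 = x 0 := rfl

lemma euc_two_ext {x y : Euc 2} (h0 : x 0 = y 0) (h1 : x 1 = y 1) : x = y := by
  ext i; fin_cases i <;> assumption

lemma continuous_quarterTurn : Continuous quarterTurn := by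
  unfold quarterTurn; fun_prop

lemma norm_quarterTurn (x : Euc 2) : ‖quarterTurn x‖ = ‖x‖ := by
  rw [← sq_eq_sq₀ (norm_nonneg _) (norm_nonneg _), norm_sq_euc_two, norm_sq_euc_two]
  simp; ring

lemma inner_sq_add_inner_quarterTurn_sq {u : Euc 2} (hu : ‖u‖ = 1) (x : Euc 2) :
    inner ℝ x u ^ 2 + inner ℝ x (quarterTurn u) ^ 2 = ‖x‖ ^ 2 := by
  rw [norm_euc_two_eq_one_iff] at hu
  rw [norm_sq_euc_two, inner_euc_two, inner_euc_two, quarterTurn_zero, quarterTurn_one]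
  linear_combination (x 0 ^ 2 + x 1 ^ 2) * hu

/-! ### Countability of the irregular boundary points -/

/-- The points of `K` at which the outer unit normal is not unique up to sign. -/
def irregularPoints (K : ConvexBody (Euc 2)) : Set (Euc 2) :=
  {s | s ∈ K ∧ ∃ n ∈ outerUnitNormals K s, ∃ m ∈ outerUnitNormals K s, n ≠ m ∧ n ≠ -m}

/-- By Lagrange's identity a vanishing cross product gives ⟨n, m⟩² = 1, and then n = ⟨n, m⟩ m. -/
lemma cross_ne_zero {n m : Euc 2} (hn : ‖n‖ = 1) (hm : ‖m‖ = 1) (h1 : n ≠ m) (h2 : n ≠ -m) :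
    n 0 * m 1 - n 1 * m 0 ≠ 0 := by
  intro h
  rw [norm_euc_two_eq_one_iff] at hn hm
  have hc : (n 0 * m 0 + n 1 * m 1) ^ 2 = 1 := by
    linear_combination (m 0 ^ 2 + m 1 ^ 2) * hn + hm - (n 0 * m 1 - n 1 * m 0) * h
  have key : ∀ c : ℝ, n 0 * m 0 + n 1 * m 1 = c → n 0 = c * m 0 ∧ n 1 = c * m 1 := by
    rintro c rfl
    constructor
    · linear_combination (-n 0) * hm + m 1 * h
    · linear_combination (-n 1) * hm - m 0 * h
  rcases sq_eq_one_iff.1 hc with hc | hc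
  · obtain ⟨h0, h1'⟩ := key _ hc
    exact h1 (euc_two_ext (by linarith) (by linarith))
  · obtain ⟨h0, h1'⟩ := key _ hc
    exact h2 (euc_two_ext (by simpa using h0) (by simpa using h1'))

/-- The cone of outer normal vectors of `K` at `s`. -/
def normalCone (K : ConvexBody (Euc 2)) (s : Euc 2) : Set (Euc 2) :=
  {w | ∀ y ∈ K, inner ℝ (y - s) w ≤ 0}

/-- If w were interior to both cones, w + ε(t - s) would still be normal at s for small ε > 0, so ⟨t
- s, w⟩ < 0; but w is normal at t, so ⟨t - s, w⟩ ≥ 0. -/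
lemma disjoint_interior_normalCone {K : ConvexBody (Euc 2)} {s t : Euc 2} (hs : s ∈ K)
    (ht : t ∈ K) (hst : s ≠ t) :
    Disjoint (interior (normalCone K s)) (interior (normalCone K t)) := by
  rw [Set.disjoint_left]
  intro w hw hw'
  have hc : Tendsto (fun ε : ℝ => w + ε • (t - s)) (𝓝[>] 0) (𝓝 w) := by
    have : Continuous (fun ε : ℝ => w + ε • (t - s)) := by fun_prop
    simpa using (this.tendsto 0).mono_left nhdsWithin_le_nhds
  have h1 := hc.eventually (mem_interior_iff_mem_nhds.1 hw)
  obtain ⟨ε, h2, hε⟩ := (h1.and self_mem_nhdsWithin).exists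
  have h3 := h2 t ht
  have h4 := interior_subset hw' s hs
  rw [inner_add_right, inner_smul_right, real_inner_self_eq_norm_sq] at h3
  rw [← neg_sub, inner_neg_left] at h4
  have h5 : 0 < ‖t - s‖ ^ 2 := by
    have := norm_pos_iff.2 (sub_ne_zero.2 hst.symm); positivity
  have h6 : 0 < ε * ‖t - s‖ ^ 2 := mul_pos hε h5
  linarith

/-- The cone contains the open set of positive combinations of n and m; the two inequalities in
`hopen` say that the coefficients given by Cramer's rule are positive, multiplied by d² to avoid
division. -/
lemma interior_normalCone_nonempty {K : ConvexBody (Euc 2)} {s n m : Euc 2}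
    (hn : n ∈ outerUnitNormals K s) (hm : m ∈ outerUnitNormals K s)
    (hd : n 0 * m 1 - n 1 * m 0 ≠ 0) : (interior (normalCone K s)).Nonempty := by
  set d := n 0 * m 1 - n 1 * m 0 with hdd
  have hd2 : 0 < d * d := mul_self_pos.2 hd
  have hopen : IsOpen {w : Euc 2 | 0 < (w 0 * m 1 - w 1 * m 0) * d ∧
      0 < (n 0 * w 1 - n 1 * w 0) * d} :=
    (isOpen_lt (by fun_prop) (by fun_prop)).and (isOpen_lt (by fun_prop) (by fun_prop))
  refine ⟨n + m, interior_maximal ?_ hopen ⟨?_, ?_⟩⟩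
  · rintro w ⟨h1, h2⟩ y hy
    have hny := hn.2 y hy
    have hmy := hm.2 y hy
    have : d * d * inner ℝ (y - s) w = (w 0 * m 1 - w 1 * m 0) * d * inner ℝ (y - s) n
        + (n 0 * w 1 - n 1 * w 0) * d * inner ℝ (y - s) m := by
      simp only [inner_euc_two]
      rw [hdd]; ring
    have h3 := mul_nonpos_of_nonneg_of_nonpos h1.le hny
    have h4 := mul_nonpos_of_nonneg_of_nonpos h2.le hmy
    by_contra! h5
    have := mul_pos hd2 h5
    linarith
  · have : ((n + m) 0 * m 1 - (n + m) 1 * m 0) * d = d * d := by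
      rw [hdd]; simp only [PiLp.add_apply]; ring
    rw [this]; exact hd2
  · have : (n 0 * (n + m) 1 - n 1 * (n + m) 0) * d = d * d := by
      rw [hdd]; simp only [PiLp.add_apply]; ring
    rw [this]; exact hd2

lemma countable_irregularPoints (K : ConvexBody (Euc 2)) : (irregularPoints K).Countable := by
  refine Set.PairwiseDisjoint.countable_of_isOpen (s := fun s => interior (normalCone K s))
    ?_ (fun _ _ => isOpen_interior) ?_
  · intro s hs t ht hst
    exact disjoint_interior_normalCone hs.1 ht.1 hst
  · rintro s ⟨-, n, hn, m, hm, h1, h2⟩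
    exact interior_normalCone_nonempty hn hm (cross_ne_zero hn.1 hm.1 h1 h2)

lemma finite_outerUnitNormals {K : ConvexBody (Euc 2)} {s : Euc 2} (hs : s ∈ K)
    (hr : s ∉ irregularPoints K) : (outerUnitNormals K s).Finite := by
  rcases (outerUnitNormals K s).eq_empty_or_nonempty with h | ⟨n, hn⟩
  · simp [h]
  · refine Set.Finite.subset (Set.toFinite {n, -n}) fun m hm => ?_
    by_contra h
    simp only [mem_insert_iff, mem_singleton_iff, not_or] at h
    exact hr ⟨hs, m, hm, n, hn, h.1, h.2⟩

/-- At a regular point, there is at most one unit normal in an open half plane. -/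
lemma eq_of_mem_outerUnitNormals {K : ConvexBody (Euc 2)} {s u n m : Euc 2} (hs : s ∈ K)
    (hr : s ∉ irregularPoints K) (hn : n ∈ outerUnitNormals K s) (hm : m ∈ outerUnitNormals K s)
    (hnu : 0 < inner ℝ u n) (hmu : 0 < inner ℝ u m) : n = m := by
  by_contra h
  refine hr ⟨hs, n, hn, m, hm, h, ?_⟩
  rintro rfl
  rw [inner_neg_right] at hnu
  linarith

lemma outerUnitNormals_eq_empty {K : ConvexBody (Euc 2)} {s : Euc 2}
    (hs : s ∈ interior (K : Set (Euc 2))) : outerUnitNormals K s = ∅ := by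
  rw [Set.eq_empty_iff_forall_notMem]
  rintro n ⟨hn, h⟩
  have hc : Tendsto (fun ε : ℝ => s + ε • n) (𝓝[>] 0) (𝓝 s) := by
    have : Continuous (fun ε : ℝ => s + ε • n) := by fun_prop
    simpa using (this.tendsto 0).mono_left nhdsWithin_le_nhds
  have h1 := hc.eventually (mem_interior_iff_mem_nhds.1 hs)
  obtain ⟨ε, h2, hε⟩ := (h1.and self_mem_nhdsWithin).exists
  have h3 := h _ h2
  rw [add_sub_cancel_left, inner_smul_left, real_inner_self_eq_norm_sq, hn] at h3
  simp at h3
  exact absurd hε (not_lt.2 h3)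

/-! ### Measurability of the visible part of the boundary and of its normal -/

lemma isClosed_normalPairs (K : ConvexBody (Euc 2)) :
    IsClosed {z : Euc 2 × Euc 2 | z.1 ∈ K ∧ z.2 ∈ outerUnitNormals K z.1} := by
  have : {z : Euc 2 × Euc 2 | z.1 ∈ K ∧ z.2 ∈ outerUnitNormals K z.1} =
      (Prod.fst ⁻¹' (K : Set (Euc 2))) ∩ ({z | ‖z.2‖ = 1} ∩
        ⋂ y ∈ (K : Set (Euc 2)), {z | inner ℝ (y - z.1) z.2 ≤ 0}) := by
    ext z; simp [outerUnitNormals]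
  rw [this]
  refine (K.isClosed.preimage continuous_fst).inter
    ((isClosed_eq (by fun_prop) (by fun_prop)).inter ?_)
  exact isClosed_biInter fun y _ => isClosed_le (by fun_prop) (by fun_prop)

lemma isCompact_normalPairs (K : ConvexBody (Euc 2)) :
    IsCompact {z : Euc 2 × Euc 2 | z.1 ∈ K ∧ z.2 ∈ outerUnitNormals K z.1} := by
  refine (K.isCompact.prod (isCompact_sphere (0 : Euc 2) 1)).of_isClosed_subset
    (isClosed_normalPairs K) ?_
  rintro ⟨s, n⟩ ⟨h1, h2⟩
  exact ⟨h1, by simpa using h2.1⟩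

/-- Relaxing ⟨u, n⟩ > 0 to ⟨u, n⟩ ≥ 1/(k+1) exhibits the set as a countable union of projections of
compact sets of pairs (s, n). -/
lemma measurableSet_exists_normal (K : ConvexBody (Euc 2)) (u : Euc 2) {C : Set (Euc 2)}
    (hC : IsClosed C) :
    MeasurableSet {s | s ∈ K ∧ ∃ n ∈ outerUnitNormals K s, n ∈ C ∧ 0 < inner ℝ u n} := by
  have : {s | s ∈ K ∧ ∃ n ∈ outerUnitNormals K s, n ∈ C ∧ 0 < inner ℝ u n} =
      ⋃ k : ℕ, Prod.fst '' ({z : Euc 2 × Euc 2 | z.1 ∈ K ∧ z.2 ∈ outerUnitNormals K z.1} ∩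
        {z | z.2 ∈ C ∧ 1 / ((k : ℝ) + 1) ≤ inner ℝ u z.2}) := by
    ext s
    simp only [mem_ofPred_eq, mem_iUnion, mem_image, mem_inter_iff, Prod.exists, exists_and_right,
      exists_eq_right]
    constructor
    · rintro ⟨hs, n, hn, hnC, hun⟩
      obtain ⟨k, hk⟩ := exists_nat_one_div_lt hun
      exact ⟨k, n, ⟨hs, hn⟩, hnC, hk.le⟩
    · rintro ⟨k, n, ⟨hs, hn⟩, hnC, hk⟩
      exact ⟨hs, n, hn, hnC, lt_of_lt_of_le (by positivity) hk⟩
  rw [this]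
  refine MeasurableSet.iUnion fun k => IsCompact.measurableSet ?_
  refine ((isCompact_normalPairs K).inter_right ?_).image continuous_fst
  exact (hC.preimage continuous_snd).and (isClosed_le (by fun_prop) (by fun_prop))

/-- The regular boundary points of `K` which have a normal in the open half plane of `u`. -/
def visiblePoints (K : ConvexBody (Euc 2)) (u : Euc 2) : Set (Euc 2) :=
  {s | s ∈ K ∧ ∃ n ∈ outerUnitNormals K s, 0 < inner ℝ u n} \ irregularPoints K

open Classical in
/-- The normal at a point of `visiblePoints K u` in the open half plane of `u`. -/
def visibleNormal (K : ConvexBody (Euc 2)) (u s : Euc 2) : Euc 2 :=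
  if h : s ∈ visiblePoints K u then h.1.2.choose else 0

lemma visibleNormal_mem {K : ConvexBody (Euc 2)} {u s : Euc 2} (h : s ∈ visiblePoints K u) :
    visibleNormal K u s ∈ outerUnitNormals K s := by
  rw [visibleNormal, dif_pos h]; exact h.1.2.choose_spec.1

lemma inner_visibleNormal_pos {K : ConvexBody (Euc 2)} {u s : Euc 2}
    (h : s ∈ visiblePoints K u) : 0 < inner ℝ u (visibleNormal K u s) := by
  rw [visibleNormal, dif_pos h]; exact h.1.2.choose_spec.2

lemma visibleNormal_eq {K : ConvexBody (Euc 2)} {u s n : Euc 2} (h : s ∈ visiblePoints K u)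
    (hn : n ∈ outerUnitNormals K s) (hu : 0 < inner ℝ u n) : visibleNormal K u s = n :=
  eq_of_mem_outerUnitNormals h.1.1 h.2 (visibleNormal_mem h) hn (inner_visibleNormal_pos h) hu

lemma measurableSet_visiblePoints (K : ConvexBody (Euc 2)) (u : Euc 2) :
    MeasurableSet (visiblePoints K u) := by
  have := measurableSet_exists_normal K u isClosed_univ
  simp only [mem_univ, true_and] at this
  exact this.diff (countable_irregularPoints K).measurableSet

lemma measurable_visibleNormal (K : ConvexBody (Euc 2)) (u : Euc 2) :
    Measurable (visibleNormal K u) := by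
  classical
  refine measurable_of_isClosed fun C hC => ?_
  -- Off the visible part the normal has the default value 0, which accounts for the second piece.
  have : visibleNormal K u ⁻¹' C =
      ({s | s ∈ K ∧ ∃ n ∈ outerUnitNormals K s, n ∈ C ∧ 0 < inner ℝ u n} ∩ visiblePoints K u) ∪
      ((visiblePoints K u)ᶜ ∩ {_s | (0 : Euc 2) ∈ C}) := by
    ext s
    by_cases h : s ∈ visiblePoints K u
    · simp only [mem_preimage, mem_union, mem_inter_iff, mem_ofPred_eq, h, and_true, mem_compl_iff,
        not_true_eq_false, false_and, or_false]
      constructor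
      · intro hC
        exact ⟨h.1.1, _, visibleNormal_mem h, hC, inner_visibleNormal_pos h⟩
      · rintro ⟨-, n, hn, hnC, hu⟩
        rwa [visibleNormal_eq h hn hu]
    · simp [visibleNormal, h]
  rw [this]
  exact ((measurableSet_exists_normal K u hC).inter (measurableSet_visiblePoints K u)).union
    ((measurableSet_visiblePoints K u).compl.inter (MeasurableSet.const _))

/-! ### Area formula for the projection along `u` -/

/-- On a line parallel to u, the half plane at a visible point s has a normal at an acute angle with
u, so no point of K lies further in the direction u than s. Two visible points on the line are
therefore equally far. -/
lemma injOn_visiblePoints (K : ConvexBody (Euc 2)) {u : Euc 2} (hu : ‖u‖ = 1) :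
    InjOn (fun s => inner ℝ s (quarterTurn u)) (visiblePoints K u) := by
  have key : ∀ s ∈ visiblePoints K u, ∀ t ∈ visiblePoints K u,
      inner ℝ s (quarterTurn u) = inner ℝ t (quarterTurn u) → inner ℝ t u ≤ inner ℝ s u := by
    intro s hs t ht h
    have h1 := (visibleNormal_mem hs).2 t ht.1.1
    have h2 := inner_visibleNormal_pos hs
    rw [norm_euc_two_eq_one_iff] at hu
    simp only [inner_euc_two, quarterTurn_zero, quarterTurn_one, PiLp.sub_apply] at *
    set n := visibleNormal K u s
    have : (t 0 - s 0) * n 0 + (t 1 - s 1) * n 1 =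
        (t 0 * u 0 + t 1 * u 1 - (s 0 * u 0 + s 1 * u 1)) * (u 0 * n 0 + u 1 * n 1) := by
      linear_combination (-((t 0 - s 0) * n 0 + (t 1 - s 1) * n 1)) * hu
        - (-n 0 * u 1 + n 1 * u 0) * h
    by_contra! h3
    have := mul_pos (sub_pos.2 h3) h2
    linarith
  intro s hs t ht h
  have h1 := le_antisymm (key s hs t ht h) (key t ht s hs h.symm)
  have h2 := inner_sq_add_inner_quarterTurn_sq hu (s - t)
  simp only at h
  rw [inner_sub_left, inner_sub_left, h1, h] at h2
  simp only [sub_self, ne_eq, OfNat.ofNat_ne_zero, not_false_eq_true, zero_pow, add_zero] at h2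
  exact sub_eq_zero.1 (norm_eq_zero.1 (pow_eq_zero_iff two_ne_zero |>.1 h2.symm))

/-- Expansion in the orthonormal frame formed by n and its quarter turn. -/
lemma inner_quarterTurn_eq {n u : Euc 2} (hn : ‖n‖ = 1) (d : Euc 2) :
    inner ℝ d (quarterTurn u) = inner ℝ n (quarterTurn u) * inner ℝ d n +
      inner ℝ u n * inner ℝ d (quarterTurn n) := by
  rw [norm_euc_two_eq_one_iff] at hn
  simp only [inner_euc_two, quarterTurn_zero, quarterTurn_one]
  linear_combination (d 0 * u 1 - d 1 * u 0) * hn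

/-- A vector d almost orthogonal to n is shortened by the projection by nearly the factor ⟨u, n⟩. In
the lower bound, one ε comes from the component of d along n and the other from replacing |⟨d, n'⟩|
by ‖d‖. -/
lemma abs_inner_quarterTurn_bounds {n u d : Euc 2} {ε : ℝ} (hn : ‖n‖ = 1) (hu : ‖u‖ = 1)
    (hc : 0 ≤ inner ℝ u n) (hd : |inner ℝ d n| ≤ ε * ‖d‖) :
    |inner ℝ d (quarterTurn u)| ≤ (inner ℝ u n + ε) * ‖d‖ ∧
    (inner ℝ u n - 2 * ε) * ‖d‖ ≤ |inner ℝ d (quarterTurn u)| := by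
  have h1 : |inner ℝ n (quarterTurn u)| ≤ 1 := by
    have := abs_real_inner_le_norm n (quarterTurn u)
    rwa [norm_quarterTurn, hn, hu, one_mul] at this
  have h2 : |inner ℝ d (quarterTurn n)| ≤ ‖d‖ := by
    have := abs_real_inner_le_norm d (quarterTurn n)
    rwa [norm_quarterTurn, hn, mul_one] at this
  have h3 : ‖d‖ - |inner ℝ d n| ≤ |inner ℝ d (quarterTurn n)| := by
    have := inner_sq_add_inner_quarterTurn_sq hn d
    rw [← sq_abs, ← sq_abs (inner ℝ d (quarterTurn n))] at this
    have h4 := abs_nonneg (inner ℝ d n)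
    have h5 := abs_nonneg (inner ℝ d (quarterTurn n))
    have h6 : ‖d‖ ≤ |inner ℝ d n| + |inner ℝ d (quarterTurn n)| :=
      abs_le_of_sq_le_sq' (by nlinarith [mul_nonneg h4 h5]) (by positivity) |>.2
    linarith
  have hc1 : inner ℝ u n ≤ 1 := by
    have := real_inner_le_norm u n
    rwa [hu, hn, one_mul] at this
  have h7 : |inner ℝ n (quarterTurn u) * inner ℝ d n| ≤ ε * ‖d‖ := by
    rw [abs_mul]
    exact (mul_le_of_le_one_left (abs_nonneg _) h1).trans hd
  have h8 : |inner ℝ u n * inner ℝ d (quarterTurn n)| =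
      inner ℝ u n * |inner ℝ d (quarterTurn n)| := by
    rw [abs_mul, abs_of_nonneg hc]
  rw [inner_quarterTurn_eq hn d]
  set a := inner ℝ n (quarterTurn u) * inner ℝ d n
  set b := inner ℝ u n * inner ℝ d (quarterTurn n)
  constructor
  · refine (abs_add_le a b).trans ?_
    have := mul_le_mul_of_nonneg_left h2 hc
    linarith
  · have h9 : |b| - |a| ≤ |a + b| := by
      have := abs_sub_abs_le_abs_sub b (-a)
      rwa [abs_neg, sub_neg_eq_add, add_comm b a] at this
    have h10 := mul_le_mul_of_nonneg_left h3 hc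
    have h11 := mul_le_mul_of_nonneg_right hc1 (abs_nonneg (inner ℝ d n))
    nlinarith

/-- A set with a unit vector `ν s` attached to each of its points such that the set lies in the
half plane through `s` with outer normal `ν s`, which makes an acute angle with `u`. -/
structure IsSupportedGraph (u : Euc 2) (ν : Euc 2 → Euc 2) (A : Set (Euc 2)) : Prop where
  norm_eq : ∀ s ∈ A, ‖ν s‖ = 1
  inner_pos : ∀ s ∈ A, 0 < inner ℝ u (ν s)
  inner_le : ∀ s ∈ A, ∀ t ∈ A, inner ℝ (t - s) (ν s) ≤ 0

lemma IsSupportedGraph.mono {u : Euc 2} {ν : Euc 2 → Euc 2} {A B : Set (Euc 2)}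
    (h : IsSupportedGraph u ν A) (hB : B ⊆ A) : IsSupportedGraph u ν B :=
  ⟨fun s hs => h.1 s (hB hs), fun s hs => h.2 s (hB hs),
    fun s hs t ht => h.3 s (hB hs) t (hB ht)⟩

/-- The support inequalities at s and at t bound ⟨t - s, ·⟩ from both sides, so chords of A are
almost orthogonal to n. The projection is then bi-Lipschitz with both constants close to ⟨u, n⟩, and
Hausdorff measure scales accordingly. -/
lemma IsSupportedGraph.volume_image_bounds {u : Euc 2} {ν : Euc 2 → Euc 2} {A : Set (Euc 2)}
    (h : IsSupportedGraph u ν A) (hu : ‖u‖ = 1) {n : Euc 2} {ε : ℝ} (hn : ‖n‖ = 1) (hε : 0 ≤ ε)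
    (hν : ∀ s ∈ A, ‖ν s - n‖ ≤ ε) (hc : 0 < inner ℝ u n - 2 * ε) :
    volume ((fun s => inner ℝ s (quarterTurn u)) '' A) ≤
      ENNReal.ofReal (inner ℝ u n + ε) * Measure.hausdorffMeasure 1 A ∧
    ENNReal.ofReal (inner ℝ u n - 2 * ε) * Measure.hausdorffMeasure 1 A ≤
      volume ((fun s => inner ℝ s (quarterTurn u)) '' A) := by
  set P : Euc 2 → ℝ := fun s => inner ℝ s (quarterTurn u) with hP
  have hcone : ∀ s ∈ A, ∀ t ∈ A, |inner ℝ (t - s) n| ≤ ε * ‖t - s‖ := by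
    have key : ∀ s ∈ A, ∀ t ∈ A, inner ℝ (t - s) n ≤ ε * ‖t - s‖ := by
      intro s hs t ht
      have h1 := h.inner_le s hs t ht
      have h2 : inner ℝ (t - s) n = inner ℝ (t - s) (ν s) - inner ℝ (t - s) (ν s - n) := by
        rw [inner_sub_right]; ring
      have h3 := abs_le.1 (abs_real_inner_le_norm (t - s) (ν s - n))
      have h4 := mul_le_mul_of_nonneg_left (hν s hs) (norm_nonneg (t - s))
      linarith [h3.1]
    intro s hs t ht
    refine abs_le.2 ⟨?_, key s hs t ht⟩
    have := key t ht s hs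
    rw [← neg_sub, inner_neg_left, norm_neg] at this
    linarith
  have hb : ∀ s ∈ A, ∀ t ∈ A, |P t - P s| ≤ (inner ℝ u n + ε) * ‖t - s‖ ∧
      (inner ℝ u n - 2 * ε) * ‖t - s‖ ≤ |P t - P s| := by
    intro s hs t ht
    have := abs_inner_quarterTurn_bounds hn hu (by linarith) (hcone s hs t ht)
    rwa [inner_sub_left] at this
  have hvol : ∀ B : Set ℝ, volume B = Measure.hausdorffMeasure 1 B := fun B => by
    rw [hausdorffMeasure_real]
  constructor
  · have hL : LipschitzOnWith (Real.toNNReal (inner ℝ u n + ε)) P A := by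
      refine LipschitzOnWith.of_dist_le_mul fun s hs t ht => ?_
      rw [Real.coe_toNNReal _ (by linarith), Real.dist_eq, dist_eq_norm]
      exact (hb t ht s hs).1
    have := hL.hausdorffMeasure_image_le zero_le_one
    rwa [ENNReal.rpow_one, ← hvol] at this
  -- The lower bound is the Lipschitz estimate for the inverse of the projection.
  · set g := Function.invFunOn P A with hg
    have hgA : ∀ t ∈ P '' A, g t ∈ A ∧ P (g t) = t := fun t ht => Function.invFunOn_pos ht
    have hL : LipschitzOnWith (Real.toNNReal (inner ℝ u n - 2 * ε)⁻¹) g (P '' A) := by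
      refine LipschitzOnWith.of_dist_le_mul fun t ht t' ht' => ?_
      obtain ⟨h1, h2⟩ := hgA t ht
      obtain ⟨h3, h4⟩ := hgA t' ht'
      have := (hb _ h3 _ h1).2
      rw [h2, h4] at this
      rw [Real.coe_toNNReal _ (inv_nonneg.2 hc.le), dist_eq_norm, Real.dist_eq, inv_mul_eq_div,
        le_div_iff₀ hc]
      linarith
    have hinj : InjOn P A := by
      intro s hs t ht hst
      have := (hb s hs t ht).2
      rw [hst, sub_self, abs_zero] at this
      have h0 : ‖t - s‖ ≤ 0 := by
        by_contra! h0
        have := mul_pos hc h0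
        linarith
      exact (sub_eq_zero.1 (norm_le_zero_iff.1 h0)).symm
    have him : g '' (P '' A) = A := hinj.invFunOn_image subset_rfl
    have := hL.hausdorffMeasure_image_le zero_le_one
    rw [ENNReal.rpow_one, ← hvol, him] at this
    calc ENNReal.ofReal (inner ℝ u n - 2 * ε) * Measure.hausdorffMeasure 1 A
        ≤ ENNReal.ofReal (inner ℝ u n - 2 * ε) *
          (ENNReal.ofReal (inner ℝ u n - 2 * ε)⁻¹ * volume (P '' A)) := by
          gcongr; exact this
      _ = volume (P '' A) := by
          rw [← mul_assoc, ← ENNReal.ofReal_mul hc.le, mul_inv_cancel₀ hc.ne', ENNReal.ofReal_one,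
            one_mul]

/-- On a piece with nearly constant normal, the integral and the projected length are both close to
⟨u, n⟩ times the length of A; r bounds the ratio in either direction. -/
lemma IsSupportedGraph.lintegral_bounds {u : Euc 2} {ν : Euc 2 → Euc 2} {A : Set (Euc 2)}
    (h : IsSupportedGraph u ν A) (hu : ‖u‖ = 1) (hA : MeasurableSet A)
    {n : Euc 2} {ε r : ℝ} (hn : ‖n‖ = 1) (hε : 0 ≤ ε)
    (hν : ∀ s ∈ A, ‖ν s - n‖ ≤ ε) (hc : 0 < inner ℝ u n - 2 * ε)
    (hr : inner ℝ u n + ε ≤ r * (inner ℝ u n - 2 * ε)) (hr0 : 0 ≤ r) :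
    volume ((fun s => inner ℝ s (quarterTurn u)) '' A) ≤ ENNReal.ofReal r *
      ∫⁻ s in A, ENNReal.ofReal (inner ℝ u (ν s)) ∂Measure.hausdorffMeasure 1 ∧
    ∫⁻ s in A, ENNReal.ofReal (inner ℝ u (ν s)) ∂Measure.hausdorffMeasure 1 ≤
      ENNReal.ofReal r * volume ((fun s => inner ℝ s (quarterTurn u)) '' A) := by
  obtain ⟨h1, h2⟩ := h.volume_image_bounds hu hn hε hν hc
  have hw : ∀ s ∈ A, |inner ℝ u (ν s) - inner ℝ u n| ≤ ε := by
    intro s hs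
    rw [← inner_sub_right]
    have := abs_real_inner_le_norm u (ν s - n)
    rw [hu, one_mul] at this
    exact this.trans (hν s hs)
  have hlow : ENNReal.ofReal (inner ℝ u n - ε) * Measure.hausdorffMeasure 1 A ≤
      ∫⁻ s in A, ENNReal.ofReal (inner ℝ u (ν s)) ∂Measure.hausdorffMeasure 1 := by
    rw [← setLIntegral_const]
    refine setLIntegral_mono' hA fun s hs => ENNReal.ofReal_le_ofReal ?_
    linarith [(abs_le.1 (hw s hs)).1]
  have hupp : ∫⁻ s in A, ENNReal.ofReal (inner ℝ u (ν s)) ∂Measure.hausdorffMeasure 1 ≤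
      ENNReal.ofReal (inner ℝ u n + ε) * Measure.hausdorffMeasure 1 A := by
    rw [← setLIntegral_const]
    refine setLIntegral_mono' hA fun s hs => ENNReal.ofReal_le_ofReal ?_
    linarith [(abs_le.1 (hw s hs)).2]
  constructor
  · calc _ ≤ _ := h1
      _ ≤ ENNReal.ofReal (r * (inner ℝ u n - ε)) * Measure.hausdorffMeasure 1 A := by
          gcongr
          nlinarith
      _ = ENNReal.ofReal r *
          (ENNReal.ofReal (inner ℝ u n - ε) * Measure.hausdorffMeasure 1 A) := by
          rw [ENNReal.ofReal_mul hr0, mul_assoc]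
      _ ≤ _ := by gcongr
  · calc _ ≤ _ := hupp
      _ ≤ ENNReal.ofReal (r * (inner ℝ u n - 2 * ε)) * Measure.hausdorffMeasure 1 A := by
          gcongr
      _ = ENNReal.ofReal r *
          (ENNReal.ofReal (inner ℝ u n - 2 * ε) * Measure.hausdorffMeasure 1 A) := by
          rw [ENNReal.ofReal_mul hr0, mul_assoc]
      _ ≤ _ := by gcongr

lemma ENNReal.le_of_forall_ofReal_one_lt_mul {a b : ENNReal}
    (h : ∀ r : ℝ, 1 < r → a ≤ ENNReal.ofReal r * b) : a ≤ b := by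
  have h1 : Tendsto (fun r : ℝ => ENNReal.ofReal r * b) (𝓝[>] 1) (𝓝 (ENNReal.ofReal 1 * b)) :=
    ENNReal.Tendsto.mul_const
      ((ENNReal.continuous_ofReal.tendsto 1).mono_left nhdsWithin_le_nhds) (Or.inl (by simp))
  rw [ENNReal.ofReal_one, one_mul] at h1
  exact ge_of_tendsto h1 (eventually_mem_nhdsWithin.mono h)

/-- By the Lindelöf property, countably many of the balls around the values of ν cover all of them;
their preimages are then made disjoint. -/
lemma exists_measurable_partition_ball {A : Set (Euc 2)} (hne : A.Nonempty)
    {ν : Euc 2 → Euc 2} (hν : Measurable ν) {e : Euc 2 → ℝ} (he : ∀ s ∈ A, 0 < e s) :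
    ∃ (f : ℕ → Euc 2) (V : ℕ → Set (Euc 2)), (∀ i, f i ∈ A) ∧ (∀ i, MeasurableSet (V i)) ∧
      Pairwise (Function.onFun Disjoint V) ∧ A ⊆ ⋃ i, V i ∧
      ∀ i, ∀ s ∈ V i, ‖ν s - ν (f i)‖ ≤ e (f i) := by
  obtain ⟨I, hIc, hI⟩ := TopologicalSpace.isOpen_iUnion_countable
    (fun s : A => Metric.ball (ν s) (e s)) (fun s => Metric.isOpen_ball)
  have hcov : ∀ s ∈ A, ν s ∈ ⋃ i ∈ I, Metric.ball (ν i) (e i) := fun s hs => by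
    rw [hI]; exact mem_iUnion.2 ⟨⟨s, hs⟩, Metric.mem_ball_self (he s hs)⟩
  have hIne : I.Nonempty := by
    obtain ⟨s, hs⟩ := hne
    obtain ⟨i, hi, -⟩ := mem_iUnion₂.1 (hcov s hs)
    exact ⟨i, hi⟩
  obtain ⟨f, rfl⟩ := hIc.exists_eq_range hIne
  refine ⟨fun i => f i, disjointed fun i => ν ⁻¹' Metric.ball (ν (f i)) (e (f i)),
    fun i => (f i).2, ?_,
    disjoint_disjointed _, ?_, ?_⟩
  · have hb : ∀ i, MeasurableSet (ν ⁻¹' Metric.ball (ν (f i)) (e (f i))) := fun i =>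
      hν Metric.isOpen_ball.measurableSet
    exact fun i => MeasurableSet.disjointed hb i
  · rw [iUnion_disjointed]
    intro s hs
    simpa using hcov s hs
  · intro i s hs
    have h1 := disjointed_subset (fun i => ν ⁻¹' Metric.ball (ν (f i)) (e (f i))) i hs
    exact (mem_ball_iff_norm.1 (mem_preimage.1 h1)).le

lemma Set.InjOn.pairwise_disjoint_image {α β ι : Type*} {P : α → β} {A : Set α}
    (hinj : InjOn P A) {V : ι → Set α} (hV : Pairwise (Function.onFun Disjoint V)) :
    Pairwise (Function.onFun Disjoint fun i => P '' (A ∩ V i)) := by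
  intro i j hij
  have := hV hij
  simp only [Function.onFun, Set.disjoint_left] at this ⊢
  rintro _ ⟨s, hs, rfl⟩ ⟨t, ht, hts⟩
  have hst : t = s := hinj ht.1 hs.1 hts
  subst hst
  exact this hs.2 ht.2

/-- Area formula for the orthogonal projection of a supported graph to the line orthogonal to
`u`. -/
theorem IsSupportedGraph.lintegral_inner_eq {u : Euc 2} {ν : Euc 2 → Euc 2} {A : Set (Euc 2)}
    (h : IsSupportedGraph u ν A) (hu : ‖u‖ = 1) (hA : MeasurableSet A) (hνm : Measurable ν)
    (hinj : InjOn (fun s => inner ℝ s (quarterTurn u)) A) :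
    ∫⁻ s in A, ENNReal.ofReal (inner ℝ u (ν s)) ∂Measure.hausdorffMeasure 1 =
      volume ((fun s => inner ℝ s (quarterTurn u)) '' A) := by
  have hPc : Continuous (fun s : Euc 2 => inner ℝ s (quarterTurn u)) := by fun_prop
  rcases A.eq_empty_or_nonempty with rfl | hne
  · simp
  suffices hsuff : ∀ r : ℝ, 1 < r →
      volume ((fun s => inner ℝ s (quarterTurn u)) '' A) ≤ ENNReal.ofReal r *
        ∫⁻ s in A, ENNReal.ofReal (inner ℝ u (ν s)) ∂Measure.hausdorffMeasure 1 ∧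
      ∫⁻ s in A, ENNReal.ofReal (inner ℝ u (ν s)) ∂Measure.hausdorffMeasure 1 ≤
        ENNReal.ofReal r * volume ((fun s => inner ℝ s (quarterTurn u)) '' A) by
    exact le_antisymm (ENNReal.le_of_forall_ofReal_one_lt_mul fun r hr => (hsuff r hr).2)
      (ENNReal.le_of_forall_ofReal_one_lt_mul fun r hr => (hsuff r hr).1)
  intro r hr
  -- With c = ⟨u, ν s⟩, this e solves c + e = r(c - 2e), the equality case of the ratio condition in
  -- `IsSupportedGraph.lintegral_bounds`.
  obtain ⟨e, he⟩ : ∃ e : Euc 2 → ℝ, ∀ s, e s = inner ℝ u (ν s) * (r - 1) / (1 + 2 * r) :=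
    ⟨_, fun _ => rfl⟩
  have hepos : ∀ s ∈ A, 0 < e s := fun s hs => by
    have := h.inner_pos s hs
    have : 0 < r - 1 := by linarith
    rw [he]
    positivity
  have her : ∀ s, inner ℝ u (ν s) + e s = r * (inner ℝ u (ν s) - 2 * e s) := fun s => by
    have : 1 + 2 * r ≠ 0 := by positivity
    rw [he]; field_simp; ring
  have hec : ∀ s ∈ A, 0 < inner ℝ u (ν s) - 2 * e s := fun s hs => by
    have h1 := her s
    have h2 := h.inner_pos s hs
    by_contra! h3
    have h4 := mul_nonpos_of_nonneg_of_nonpos (by linarith : 0 ≤ r) h3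
    linarith [hepos s hs]
  obtain ⟨f, V, hf, hVm, hVd, hAV, hfV⟩ := exists_measurable_partition_ball hne hνm hepos
  replace hAV : A = ⋃ i, A ∩ V i := by rw [← inter_iUnion, inter_eq_left.2 hAV]
  have hm : ∀ i, MeasurableSet (A ∩ V i) := fun i => hA.inter (hVm i)
  have hint : ∫⁻ s in A, ENNReal.ofReal (inner ℝ u (ν s)) ∂Measure.hausdorffMeasure 1 =
      ∑' i, ∫⁻ s in A ∩ V i, ENNReal.ofReal (inner ℝ u (ν s)) ∂Measure.hausdorffMeasure 1 := by
    conv_lhs => rw [hAV]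
    exact lintegral_iUnion hm
      (fun i j hij => (hVd hij).mono inter_subset_right inter_subset_right) _
  have hvol : volume ((fun s => inner ℝ s (quarterTurn u)) '' A) =
      ∑' i, volume ((fun s => inner ℝ s (quarterTurn u)) '' (A ∩ V i)) := by
    conv_lhs => rw [hAV, image_iUnion]
    exact measure_iUnion (hinj.pairwise_disjoint_image hVd) fun i =>
      (hm i).image_of_continuousOn_injOn hPc.continuousOn (hinj.mono inter_subset_left)
  have hpiece := fun i =>
    (h.mono (inter_subset_left (s := A) (t := V i))).lintegral_bounds hu (hm i)
      (h.norm_eq _ (hf i)) (hepos _ (hf i)).le (fun s hs => hfV i s hs.2)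
      (hec _ (hf i)) (her (f i)).le (by linarith)
  rw [hint, hvol, ← ENNReal.tsum_mul_left, ← ENNReal.tsum_mul_left]
  exact ⟨ENNReal.tsum_le_tsum fun i => (hpiece i).1, ENNReal.tsum_le_tsum fun i => (hpiece i).2⟩

/-! ### Boundary integrals as one-dimensional integrals of slices -/

lemma visiblePoints_isSupportedGraph (K : ConvexBody (Euc 2)) (u : Euc 2) :
    IsSupportedGraph u (visibleNormal K u) (visiblePoints K u) :=
  ⟨fun _ hs => (visibleNormal_mem hs).1, fun _ hs => inner_visibleNormal_pos hs,
    fun _ hs t ht => (visibleNormal_mem hs).2 t ht.1.1⟩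

/-- The sum of `F s n` over the outer unit normals `n` of `K` at `s`. -/
def normalSum (F : Euc 2 → Euc 2 → ℝ) (K : ConvexBody (Euc 2)) (s : Euc 2) : ℝ :=
  ∑ᶠ n ∈ outerUnitNormals K s, F s n

/-- The function `G` of boundary points and normals in terms of the coordinate orthogonal to `u`,
on the part of the boundary visible in the direction `u`. -/
def slice (G : Euc 2 → Euc 2 → ℝ) (K : ConvexBody (Euc 2)) (u : Euc 2) : ℝ → ℝ :=
  Function.extend (fun s : visiblePoints K u => inner ℝ (s : Euc 2) (quarterTurn u))
    (fun s => G s (visibleNormal K u s)) 0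

lemma measurableEmbedding_visiblePoints (K : ConvexBody (Euc 2)) {u : Euc 2} (hu : ‖u‖ = 1) :
    MeasurableEmbedding (fun s : visiblePoints K u => inner ℝ (s : Euc 2) (quarterTurn u)) :=
  ContinuousOn.measurableEmbedding (f := fun s : Euc 2 => inner ℝ s (quarterTurn u))
    (measurableSet_visiblePoints K u) (by fun_prop) (injOn_visiblePoints K hu)

lemma slice_inner (G : Euc 2 → Euc 2 → ℝ) {K : ConvexBody (Euc 2)} {u s : Euc 2} (hu : ‖u‖ = 1)
    (hs : s ∈ visiblePoints K u) :
    slice G K u (inner ℝ s (quarterTurn u)) = G s (visibleNormal K u s) :=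
  (measurableEmbedding_visiblePoints K hu).injective.extend_apply _ _ ⟨s, hs⟩

lemma slice_eq_zero (G : Euc 2 → Euc 2 → ℝ) {K : ConvexBody (Euc 2)} {u : Euc 2} {t : ℝ}
    (ht : t ∉ (fun s => inner ℝ s (quarterTurn u)) '' visiblePoints K u) : slice G K u t = 0 := by
  rw [slice, Function.extend_apply']
  · rfl
  · rintro ⟨⟨s, hs⟩, h⟩
    exact ht ⟨s, hs, h⟩

lemma measurable_slice {G : Euc 2 → Euc 2 → ℝ}
    (hG : Continuous fun z : Euc 2 × Euc 2 => G z.1 z.2) (K : ConvexBody (Euc 2)) {u : Euc 2}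
    (hu : ‖u‖ = 1) : Measurable (slice G K u) := by
  refine (measurableEmbedding_visiblePoints K hu).measurable_extend ?_ measurable_const
  exact hG.measurable.comp (measurable_subtype_coe.prodMk
    ((measurable_visibleNormal K u).comp measurable_subtype_coe))

lemma abs_inner_quarterTurn_le {u s : Euc 2} (hu : ‖u‖ = 1) :
    |inner ℝ s (quarterTurn u)| ≤ ‖s‖ := by
  simpa [norm_quarterTurn, hu] using abs_real_inner_le_norm s (quarterTurn u)

lemma abs_slice_le {G : Euc 2 → Euc 2 → ℝ} {K : ConvexBody (Euc 2)} {u : Euc 2} (hu : ‖u‖ = 1)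
    {R C : ℝ} (hR : ∀ s ∈ K, ‖s‖ ≤ R) (hC : ∀ s n, ‖s‖ ≤ R → ‖n‖ = 1 → |G s n| ≤ C) (t : ℝ) :
    |slice G K u t| ≤ (Icc (-R) R).indicator (fun _ => C) t := by
  by_cases ht : t ∈ (fun s => inner ℝ s (quarterTurn u)) '' visiblePoints K u
  · obtain ⟨s, hs, rfl⟩ := ht
    have hm : inner ℝ s (quarterTurn u) ∈ Icc (-R) R :=
      abs_le.1 ((abs_inner_quarterTurn_le hu).trans (hR s hs.1.1))
    simp only
    rw [indicator_of_mem hm, slice_inner G hu hs]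
    exact hC _ _ (hR s hs.1.1) (visibleNormal_mem hs).1
  · rw [slice_eq_zero G ht, abs_zero]
    by_cases h : t ∈ Icc (-R) R
    · rw [indicator_of_mem h]
      have h0 : (0 : ℝ) ≤ R := by linarith [h.1.trans h.2]
      obtain ⟨n, hn⟩ : ∃ n : Euc 2, ‖n‖ = 1 := ⟨u, hu⟩
      exact (abs_nonneg _).trans (hC 0 n (by simpa using h0) hn)
    · rw [indicator_of_notMem h]

lemma exists_bound_of_continuous {G : Euc 2 → Euc 2 → ℝ}
    (hG : Continuous fun z : Euc 2 × Euc 2 => G z.1 z.2) (R : ℝ) :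
    ∃ C, ∀ s n, ‖s‖ ≤ R → ‖n‖ = 1 → |G s n| ≤ C := by
  obtain ⟨C, hC⟩ := ((isCompact_closedBall (0 : Euc 2) R).prod
    (isCompact_sphere (0 : Euc 2) 1)).exists_bound_of_continuousOn hG.continuousOn
  exact ⟨C, fun s n hs hn => hC (s, n) ⟨by simpa using hs, by simpa using hn⟩⟩

lemma ConvexBody.exists_norm_le (K : ConvexBody (Euc 2)) : ∃ R, ∀ s ∈ K, ‖s‖ ≤ R := by
  obtain ⟨R, -, hR⟩ := K.isBounded.exists_pos_norm_le
  exact ⟨R, hR⟩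

lemma integrable_slice {G : Euc 2 → Euc 2 → ℝ}
    (hG : Continuous fun z : Euc 2 × Euc 2 => G z.1 z.2) (K : ConvexBody (Euc 2)) {u : Euc 2}
    (hu : ‖u‖ = 1) : Integrable (slice G K u) := by
  obtain ⟨R, hR⟩ := K.exists_norm_le
  obtain ⟨C, hC⟩ := exists_bound_of_continuous hG R
  have hi : Integrable ((Icc (-R) R).indicator (fun _ => C)) volume :=
    (integrable_indicator_iff measurableSet_Icc).2 (integrableOn_const (by simp))
  exact hi.mono' (measurable_slice hG K hu).aestronglyMeasurable
    (Eventually.of_forall fun t => abs_slice_le hu hR hC t)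

/-- The area formula, applied to the part of the visible set over each measurable B, as an identity
of measures; it transports integrability and integrals together. -/
lemma map_withDensity_visiblePoints (K : ConvexBody (Euc 2)) {u : Euc 2} (hu : ‖u‖ = 1) :
    Measure.map (fun s => inner ℝ s (quarterTurn u))
      (((Measure.hausdorffMeasure 1).restrict (visiblePoints K u)).withDensity
        fun s => ENNReal.ofReal (inner ℝ u (visibleNormal K u s))) =
    volume.restrict ((fun s => inner ℝ s (quarterTurn u)) '' visiblePoints K u) := by
  have hP : Measurable fun s : Euc 2 => inner ℝ s (quarterTurn u) :=
    Continuous.measurable (by fun_prop)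
  ext B hB
  have hT := measurableSet_visiblePoints K u
  rw [Measure.map_apply hP hB, withDensity_apply _ (hP hB), Measure.restrict_restrict (hP hB),
    Measure.restrict_apply hB, inter_comm,
    ((visiblePoints_isSupportedGraph K u).mono inter_subset_left).lintegral_inner_eq hu
      (hT.inter (hP hB)) (measurable_visibleNormal K u)
      ((injOn_visiblePoints K hu).mono inter_subset_left), image_inter_preimage, inter_comm]

lemma slice_integral_aux {G : Euc 2 → Euc 2 → ℝ}
    (hG : Continuous fun z : Euc 2 × Euc 2 => G z.1 z.2) (K : ConvexBody (Euc 2)) {u : Euc 2}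
    (hu : ‖u‖ = 1) :
    IntegrableOn (fun s => G s (visibleNormal K u s) * inner ℝ u (visibleNormal K u s))
      (visiblePoints K u) (Measure.hausdorffMeasure 1) ∧
    ∫ s in visiblePoints K u, G s (visibleNormal K u s) * inner ℝ u (visibleNormal K u s)
      ∂Measure.hausdorffMeasure 1 = ∫ t, slice G K u t := by
  have hP : Measurable fun s : Euc 2 => inner ℝ s (quarterTurn u) :=
    Continuous.measurable (by fun_prop)
  have hT := measurableSet_visiblePoints K u
  have hw : Measurable fun s => ENNReal.ofReal (inner ℝ u (visibleNormal K u s)) := by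
    have : Continuous fun n : Euc 2 => ENNReal.ofReal (inner ℝ u n) :=
      ENNReal.continuous_ofReal.comp (by fun_prop)
    exact this.measurable.comp (measurable_visibleNormal K u)
  have hmeas := measurable_slice hG K hu
  have hPT : MeasurableSet ((fun s => inner ℝ s (quarterTurn u)) '' visiblePoints K u) :=
    hT.image_of_continuousOn_injOn (by fun_prop) (injOn_visiblePoints K hu)
  have heq : EqOn (fun s => (ENNReal.ofReal (inner ℝ u (visibleNormal K u s))).toReal •
      slice G K u (inner ℝ s (quarterTurn u)))
      (fun s => G s (visibleNormal K u s) * inner ℝ u (visibleNormal K u s))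
      (visiblePoints K u) := fun s hs => by
    simp only
    rw [slice_inner G hu hs, ENNReal.toReal_ofReal (inner_visibleNormal_pos hs).le, smul_eq_mul,
      mul_comm]
  constructor
  · have h1 : Integrable (slice G K u) (Measure.map (fun s => inner ℝ s (quarterTurn u))
      (((Measure.hausdorffMeasure 1).restrict (visiblePoints K u)).withDensity
        fun s => ENNReal.ofReal (inner ℝ u (visibleNormal K u s)))) := by
      rw [map_withDensity_visiblePoints K hu]
      exact (integrable_slice hG K hu).integrableOn
    have h2 := (integrable_map_measure hmeas.aestronglyMeasurable hP.aemeasurable).1 h1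
    rw [integrable_withDensity_iff_integrable_smul' hw (by simp)] at h2
    exact IntegrableOn.congr_fun h2 heq hT
  · rw [← setIntegral_eq_integral_of_forall_compl_eq_zero (fun t ht => slice_eq_zero G ht),
      ← map_withDensity_visiblePoints K hu, integral_map hP.aemeasurable
        hmeas.aestronglyMeasurable, integral_withDensity_eq_integral_toReal_smul hw (by simp)]
    exact (setIntegral_congr_fun hT heq).symm

/-- The weight kills every normal outside the open half plane of u, and a regular point has at most
one normal inside it. -/
lemma normalSum_posPart (G : Euc 2 → Euc 2 → ℝ) {K : ConvexBody (Euc 2)} (u : Euc 2) {s : Euc 2}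
    (hs : s ∈ K) (hr : s ∉ irregularPoints K) :
    normalSum (fun s n => G s n * max 0 (inner ℝ u n)) K s = (visiblePoints K u).indicator
      (fun s => G s (visibleNormal K u s) * inner ℝ u (visibleNormal K u s)) s := by
  rw [normalSum]
  by_cases h : s ∈ visiblePoints K u
  · have hp := inner_visibleNormal_pos h
    rw [indicator_of_mem h, finsum_mem_inter_support_eq _ _ {visibleNormal K u s},
      finsum_mem_singleton, max_eq_right hp.le]
    ext n
    simp only [mem_inter_iff, Function.mem_support, mem_singleton_iff, and_congr_left_iff]
    intro hn
    constructor
    · intro hnN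
      refine (visibleNormal_eq h hnN ?_).symm
      by_contra! hle
      exact hn (by rw [max_eq_left hle, mul_zero])
    · rintro rfl
      exact visibleNormal_mem h
  · rw [indicator_of_notMem h]
    refine finsum_mem_eq_zero_of_forall_eq_zero fun n hn => ?_
    rw [max_eq_left, mul_zero]
    by_contra! hlt
    exact h ⟨⟨hs, n, hn, hlt⟩, hr⟩

lemma ae_notMem_irregularPoints (K : ConvexBody (Euc 2)) (μ : Measure (Euc 2))
    (hμ : μ ≤ Measure.hausdorffMeasure 1) : ∀ᵐ s ∂μ, s ∉ irregularPoints K := by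
  have := Measure.nullSingletonClass_hausdorff (Euc 2) one_pos
  exact measure_mono_null (fun s hs => not_not.1 hs) (le_antisymm ((hμ _).trans
    ((countable_irregularPoints K).measure_zero (Measure.hausdorffMeasure 1)).le) zero_le)

lemma ae_mem_notMem_irregularPoints (K : ConvexBody (Euc 2)) :
    ∀ᵐ s ∂(Measure.hausdorffMeasure 1).restrict (K : Set (Euc 2)),
      s ∈ K ∧ s ∉ irregularPoints K := by
  filter_upwards [ae_notMem_irregularPoints K _ Measure.restrict_le_self,
    ae_restrict_mem K.isClosed.measurableSet] with s h1 h2 using ⟨h2, h1⟩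

lemma visiblePoints_subset (K : ConvexBody (Euc 2)) (u : Euc 2) :
    visiblePoints K u ⊆ (K : Set (Euc 2)) := fun _ hs => hs.1.1

theorem integrableOn_normalSum_posPart {G : Euc 2 → Euc 2 → ℝ}
    (hG : Continuous fun z : Euc 2 × Euc 2 => G z.1 z.2) (K : ConvexBody (Euc 2)) {u : Euc 2}
    (hu : ‖u‖ = 1) :
    IntegrableOn (normalSum (fun s n => G s n * max 0 (inner ℝ u n)) K) (K : Set (Euc 2))
      (Measure.hausdorffMeasure 1) := by
  have h1 := (slice_integral_aux hG K hu).1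
  rw [← integrable_indicator_iff (measurableSet_visiblePoints K u)] at h1
  refine (h1.integrableOn (s := (K : Set (Euc 2)))).congr ?_
  filter_upwards [ae_mem_notMem_irregularPoints K] with s hs
  exact (normalSum_posPart G u hs.1 hs.2).symm

theorem integral_normalSum_posPart {G : Euc 2 → Euc 2 → ℝ}
    (hG : Continuous fun z : Euc 2 × Euc 2 => G z.1 z.2) (K : ConvexBody (Euc 2)) {u : Euc 2}
    (hu : ‖u‖ = 1) :
    ∫ s in (K : Set (Euc 2)), normalSum (fun s n => G s n * max 0 (inner ℝ u n)) K s
      ∂Measure.hausdorffMeasure 1 = ∫ t, slice G K u t := by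
  rw [← (slice_integral_aux hG K hu).2,
    ← inter_eq_right.2 (visiblePoints_subset K u),
    ← setIntegral_indicator (measurableSet_visiblePoints K u)]
  refine integral_congr_ae ?_
  filter_upwards [ae_mem_notMem_irregularPoints K] with s hs
  exact normalSum_posPart G u hs.1 hs.2

/-! ### General kernels, by a partition into the four axis directions -/

/-- The four directions of the coordinate axes. -/
def axisDirection (i : Fin 4) : Euc 2 := ![!₂[1, 0], !₂[-1, 0], !₂[0, 1], !₂[0, -1]] i

lemma norm_axisDirection (i : Fin 4) : ‖axisDirection i‖ = 1 := by
  rw [norm_euc_two_eq_one_iff]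
  fin_cases i <;> simp [axisDirection]

lemma max_zero_sq_add (x : ℝ) : max 0 x ^ 2 + max 0 (-x) ^ 2 = x ^ 2 := by
  rcases le_total 0 x with h | h
  · rw [max_eq_right h, max_eq_left (by linarith)]; ring
  · rw [max_eq_left h, max_eq_right (by linarith)]; ring

lemma sum_axisDirection_sq (n : Euc 2) :
    ∑ i, max 0 (inner ℝ (axisDirection i) n) ^ 2 = ‖n‖ ^ 2 := by
  rw [norm_sq_euc_two, ← max_zero_sq_add (n 0), ← max_zero_sq_add (n 1)]
  simp only [Fin.sum_univ_four, inner_euc_two, axisDirection]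
  simp [add_assoc]

lemma normalSum_finset_sum {ι : Type*} (I : Finset ι) (F : ι → Euc 2 → Euc 2 → ℝ)
    {K : ConvexBody (Euc 2)} {s : Euc 2} (hs : s ∈ K) (hr : s ∉ irregularPoints K) :
    normalSum (fun s n => ∑ i ∈ I, F i s n) K s = ∑ i ∈ I, normalSum (F i) K s := by
  simp only [normalSum]
  have hf := finite_outerUnitNormals hs hr
  simp_rw [finsum_mem_eq_finite_toFinset_sum _ hf]
  exact Finset.sum_comm

lemma normalSum_congr {F F' : Euc 2 → Euc 2 → ℝ} {K : ConvexBody (Euc 2)} {s : Euc 2}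
    (h : ∀ n, ‖n‖ = 1 → F s n = F' s n) : normalSum F K s = normalSum F' K s :=
  finsum_mem_congr rfl fun n hn => h n hn.1

/-- The squared positive parts form a partition of unity on the circle. The square matters: one
factor is the Jacobian of the projection, and the other stays in the kernel and keeps it continuous.
-/
lemma normalSum_eq_sum_axisDirection (F : Euc 2 → Euc 2 → ℝ) {K : ConvexBody (Euc 2)} {s : Euc 2}
    (hs : s ∈ K) (hr : s ∉ irregularPoints K) :
    normalSum F K s = ∑ i, normalSum (fun s n => (F s n * max 0 (inner ℝ (axisDirection i) n)) *
      max 0 (inner ℝ (axisDirection i) n)) K s := by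
  rw [← normalSum_finset_sum _ _ hs hr]
  refine normalSum_congr fun n hn => ?_
  simp_rw [mul_assoc, ← Finset.mul_sum, ← sq]
  rw [sum_axisDirection_sq, hn]; ring

theorem integrableOn_normalSum {F : Euc 2 → Euc 2 → ℝ}
    (hF : Continuous fun z : Euc 2 × Euc 2 => F z.1 z.2) (K : ConvexBody (Euc 2)) :
    IntegrableOn (normalSum F K) (K : Set (Euc 2)) (Measure.hausdorffMeasure 1) := by
  have h : IntegrableOn (fun s => ∑ i, normalSum (fun s n =>
      (F s n * max 0 (inner ℝ (axisDirection i) n)) * max 0 (inner ℝ (axisDirection i) n)) K s)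
      (K : Set (Euc 2)) (Measure.hausdorffMeasure 1) :=
    integrable_finsetSum _ fun i _ => integrableOn_normalSum_posPart (G := fun s n =>
      F s n * max 0 (inner ℝ (axisDirection i) n)) (by fun_prop) K (norm_axisDirection i)
  refine h.congr ?_
  filter_upwards [ae_mem_notMem_irregularPoints K] with s hs
  exact (normalSum_eq_sum_axisDirection F hs.1 hs.2).symm

/-- The integral of `F s n` over the pairs of boundary points and outer unit normals of `K`. -/
def boundaryIntegral (F : Euc 2 → Euc 2 → ℝ) (K : ConvexBody (Euc 2)) : ℝ :=
  ∫ s in (K : Set (Euc 2)), normalSum F K s ∂Measure.hausdorffMeasure 1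

theorem boundaryIntegral_eq_sum_slice {F : Euc 2 → Euc 2 → ℝ}
    (hF : Continuous fun z : Euc 2 × Euc 2 => F z.1 z.2) (K : ConvexBody (Euc 2)) :
    boundaryIntegral F K = ∑ i, ∫ t, slice
      (fun s n => F s n * max 0 (inner ℝ (axisDirection i) n)) K (axisDirection i) t := by
  have hc : ∀ i, Continuous fun z : Euc 2 × Euc 2 =>
      F z.1 z.2 * max 0 (inner ℝ (axisDirection i) z.2) := fun i => by fun_prop
  rw [Finset.sum_congr rfl fun i _ => (integral_normalSum_posPart (G := fun s n =>
    F s n * max 0 (inner ℝ (axisDirection i) n)) (hc i) K (norm_axisDirection i)).symm]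
  rw [← integral_finsetSum _ fun i _ => integrableOn_normalSum_posPart (G := fun s n =>
    F s n * max 0 (inner ℝ (axisDirection i) n)) (hc i) K (norm_axisDirection i)]
  refine integral_congr_ae ?_
  filter_upwards [ae_mem_notMem_irregularPoints K] with s hs
  exact normalSum_eq_sum_axisDirection F hs.1 hs.2

theorem boundaryIntegral_finset_sum {ι : Type*} (I : Finset ι) {F : ι → Euc 2 → Euc 2 → ℝ}
    (hF : ∀ i ∈ I, Continuous fun z : Euc 2 × Euc 2 => F i z.1 z.2) (K : ConvexBody (Euc 2)) :
    boundaryIntegral (fun s n => ∑ i ∈ I, F i s n) K = ∑ i ∈ I, boundaryIntegral (F i) K := by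
  simp only [boundaryIntegral]
  rw [← integral_finsetSum _ fun i hi => integrableOn_normalSum (hF i hi) K]
  refine integral_congr_ae ?_
  filter_upwards [ae_mem_notMem_irregularPoints K] with s hs
  exact normalSum_finset_sum I F hs.1 hs.2

lemma normalSum_const_mul (c : ℝ) (F : Euc 2 → Euc 2 → ℝ) (K : ConvexBody (Euc 2)) (s : Euc 2) :
    normalSum (fun s n => c * F s n) K s = c * normalSum F K s := by
  simp only [normalSum, ← smul_eq_mul, smul_finsum]

lemma boundaryIntegral_const_mul (c : ℝ) (F : Euc 2 → Euc 2 → ℝ) (K : ConvexBody (Euc 2)) :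
    boundaryIntegral (fun s n => c * F s n) K = c * boundaryIntegral F K := by
  simp only [boundaryIntegral, normalSum_const_mul, integral_const_mul]

lemma boundaryIntegral_congr {F F' : Euc 2 → Euc 2 → ℝ} {K : ConvexBody (Euc 2)}
    (h : ∀ s n, ‖n‖ = 1 → F s n = F' s n) : boundaryIntegral F K = boundaryIntegral F' K :=
  integral_congr_ae (Eventually.of_forall fun s => normalSum_congr fun n hn => h s n hn)

lemma boundaryIntegral_add {F F' : Euc 2 → Euc 2 → ℝ}
    (hF : Continuous fun z : Euc 2 × Euc 2 => F z.1 z.2)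
    (hF' : Continuous fun z : Euc 2 × Euc 2 => F' z.1 z.2) (K : ConvexBody (Euc 2)) :
    boundaryIntegral (fun s n => F s n + F' s n) K =
      boundaryIntegral F K + boundaryIntegral F' K := by
  have := boundaryIntegral_finset_sum (F := fun i : Fin 2 => ![F, F'] i) Finset.univ
    (fun i _ => by fin_cases i <;> assumption) K
  simpa [Fin.sum_univ_two] using this

lemma normalSum_eq_zero_of_mem_interior (F : Euc 2 → Euc 2 → ℝ) {K : ConvexBody (Euc 2)}
    {s : Euc 2} (hs : s ∈ interior (K : Set (Euc 2))) : normalSum F K s = 0 := by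
  rw [normalSum, outerUnitNormals_eq_empty hs, finsum_mem_empty]

lemma setIntegral_frontier_normalSum (F : Euc 2 → Euc 2 → ℝ) (K : ConvexBody (Euc 2)) :
    ∫ s in frontier (K : Set (Euc 2)), normalSum F K s ∂Measure.hausdorffMeasure 1 =
      boundaryIntegral F K := by
  refine (setIntegral_eq_of_subset_of_forall_sdiff_eq_zero K.isClosed.measurableSet
    K.isClosed.frontier_subset fun s hs => ?_).symm
  rw [K.isClosed.frontier_eq] at hs
  exact normalSum_eq_zero_of_mem_interior F (by_contra fun h => hs.2 ⟨hs.1, h⟩)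

/-! ### Continuity in the Hausdorff metric -/

lemma ConvexBody.exists_dist_le {d : ℕ} (K L : ConvexBody (Euc d)) {x : Euc d} (hx : x ∈ K) :
    ∃ y ∈ L, dist x y ≤ dist K L := by
  obtain ⟨y, hy, h⟩ := L.isCompact.exists_infDist_eq_dist L.nonempty x
  refine ⟨y, hy, ?_⟩
  rw [← h, ← ConvexBody.hausdorffDist_coe]
  exact Metric.infDist_le_hausdorffDist_of_mem hx ConvexBody.hausdorffEDist_ne_top

lemma inner_eq_coordinates {u : Euc 2} (hu : ‖u‖ = 1) (d n : Euc 2) :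
    inner ℝ d n = inner ℝ d u * inner ℝ u n +
      inner ℝ d (quarterTurn u) * inner ℝ (quarterTurn u) n := by
  rw [norm_euc_two_eq_one_iff] at hu
  simp only [inner_euc_two, quarterTurn_zero, quarterTurn_one]
  linear_combination (-(d 0 * n 0 + d 1 * n 1)) * hu

/-- If ⟨u, n⟩ = 0, then n is plus or minus the quarter turn of u, and s would be extremal for the
projection, contradicting y or z. -/
lemma inner_pos_of_mem_outerUnitNormals {K : ConvexBody (Euc 2)} {u s n y z : Euc 2}
    (hu : ‖u‖ = 1) (hn : n ∈ outerUnitNormals K s) (hun : 0 ≤ inner ℝ u n) (hy : y ∈ K)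
    (hz : z ∈ K) (hys : inner ℝ y (quarterTurn u) < inner ℝ s (quarterTurn u))
    (hsz : inner ℝ s (quarterTurn u) < inner ℝ z (quarterTurn u)) : 0 < inner ℝ u n := by
  refine lt_of_le_of_ne hun fun h => ?_
  have h1 := hn.2 y hy
  have h2 := hn.2 z hz
  rw [inner_eq_coordinates hu, ← h, mul_zero, zero_add, inner_sub_left] at h1 h2
  have h3 := inner_eq_coordinates hu n n
  rw [real_inner_self_eq_norm_sq, hn.1, ← h, mul_zero, zero_add,
    real_inner_comm (quarterTurn u) n] at h3
  have h4 : inner ℝ (quarterTurn u) n = 0 := by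
    refine le_antisymm ?_ ?_
    · by_contra! h5
      have := mul_pos (sub_pos.2 hsz) h5
      linarith
    · by_contra! h5
      have := mul_pos_of_neg_of_neg (sub_neg.2 hys) h5
      linarith
  rw [h4] at h3
  norm_num at h3

lemma exists_separating_normal {K : ConvexBody (Euc 2)} {x : Euc 2} (hx : x ∉ K) :
    ∃ n : Euc 2, ‖n‖ = 1 ∧ ∀ a ∈ K, inner ℝ (a - x) n < 0 := by
  obtain ⟨f, v, h1, h2⟩ := geometric_hahn_banach_closed_point K.convex K.isClosed hx
  obtain ⟨w, rfl⟩ := (InnerProductSpace.toDual ℝ (Euc 2)).surjective f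
  simp only [InnerProductSpace.toDual_apply_apply] at h1 h2
  have hneg : ∀ a ∈ K, inner ℝ (a - x) w < 0 := fun a ha => by
    rw [inner_sub_left, real_inner_comm w a, real_inner_comm w x]
    linarith [h1 a ha]
  have hw : 0 < ‖w‖ := by
    obtain ⟨a, ha⟩ := K.nonempty
    rw [norm_pos_iff]
    rintro rfl
    simpa using hneg a ha
  refine ⟨‖w‖⁻¹ • w, ?_, fun a ha => ?_⟩
  · rw [norm_smul, norm_inv, norm_norm, inv_mul_cancel₀ hw.ne']
  · rw [inner_smul_right]
    exact mul_neg_of_pos_of_neg (inv_pos.2 hw) (hneg a ha)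

lemma inner_quarterTurn_self (u : Euc 2) : inner ℝ u (quarterTurn u) = 0 := by
  rw [inner_euc_two, quarterTurn_zero, quarterTurn_one]; ring

/-- Let s be the point of the fibre over t furthest in the direction u. The points s + u/(k+1) lie
outside K and can be separated from it; a limit n of the separating normals is normal at s with ⟨u,
n⟩ ≥ 0, and strictness holds because t is not extremal. -/
lemma exists_normal_of_lt {K : ConvexBody (Euc 2)} {u y z : Euc 2} {t : ℝ} (hu : ‖u‖ = 1)
    (hy : y ∈ K) (hz : z ∈ K) (hyt : inner ℝ y (quarterTurn u) < t)
    (htz : t < inner ℝ z (quarterTurn u)) :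
    ∃ s ∈ K, inner ℝ s (quarterTurn u) = t ∧ ∃ n ∈ outerUnitNormals K s, 0 < inner ℝ u n := by
  have hPc : Continuous fun s : Euc 2 => inner ℝ s (quarterTurn u) := by fun_prop
  have hS : IsCompact ((K : Set (Euc 2)) ∩ {s | inner ℝ s (quarterTurn u) = t}) :=
    K.isCompact.inter_right (isClosed_eq hPc continuous_const)
  have hSne : ((K : Set (Euc 2)) ∩ {s | inner ℝ s (quarterTurn u) = t}).Nonempty := by
    obtain ⟨s, hs, hst⟩ := K.convex.isPreconnected.intermediate_value hy hz hPc.continuousOn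
      ⟨hyt.le, htz.le⟩
    exact ⟨s, hs, hst⟩
  obtain ⟨s, ⟨hsK, hst⟩, hmax⟩ := hS.exists_isMaxOn hSne
    (f := fun s => inner ℝ s u) (by fun_prop)
  rw [isMaxOn_iff] at hmax
  have hx : ∀ k : ℕ, s + (1 / ((k : ℝ) + 1)) • u ∉ K := fun k hk => by
    have h1 : inner ℝ (s + (1 / ((k : ℝ) + 1)) • u) (quarterTurn u) = t := by
      rw [inner_add_left, inner_smul_left, inner_quarterTurn_self, hst]; simp
    have h2 := hmax _ ⟨hk, h1⟩
    rw [inner_add_left, inner_smul_left, real_inner_self_eq_norm_sq, hu] at h2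
    have : (0 : ℝ) < 1 / ((k : ℝ) + 1) := by positivity
    simp only [conj_trivial, one_pow, mul_one] at h2
    linarith
  choose n hn1 hn2 using fun k => exists_separating_normal (hx k)
  obtain ⟨n₀, hn₀, ψ, hψ, hlim⟩ := (isCompact_sphere (0 : Euc 2) 1).tendsto_subseq
    (x := n) (fun k => by simpa using hn1 k)
  have hxlim : Tendsto (fun k => s + (1 / ((ψ k : ℝ) + 1)) • u) atTop (𝓝 s) := by
    have h1 : Tendsto (fun k => (1 / ((ψ k : ℝ) + 1))) atTop (𝓝 0) :=
      tendsto_one_div_add_atTop_nhds_zero_nat.comp hψ.tendsto_atTop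
    simpa using (h1.smul_const u).const_add s
  have hN : n₀ ∈ outerUnitNormals K s := by
    refine ⟨by simpa using hn₀, fun a ha => ?_⟩
    exact le_of_tendsto ((hxlim.const_sub a).inner hlim)
      (Eventually.of_forall fun k => (hn2 (ψ k) a ha).le)
  have hun : 0 ≤ inner ℝ u n₀ := by
    refine ge_of_tendsto ((tendsto_const_nhds (x := u)).inner hlim)
      (Eventually.of_forall fun k => ?_)
    have h1 := hn2 (ψ k) s hsK
    rw [sub_add_cancel_left, inner_neg_left, inner_smul_left] at h1
    have h2 : (0 : ℝ) < 1 / ((ψ k : ℝ) + 1) := by positivity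
    simp only [conj_trivial] at h1
    by_contra! h3
    have := mul_neg_of_pos_of_neg h2 h3
    simp only [Function.comp_apply] at this
    linarith
  refine ⟨s, hsK, hst, n₀, hN, inner_pos_of_mem_outerUnitNormals hu hN hun hy hz ?_ ?_⟩
  · rw [hst]; exact hyt
  · rw [hst]; exact htz

/-- Pairs (point, normal) form a closed relation even when the body varies: replacing y ∈ K by a
nearby point of κ k costs at most the Hausdorff distance. -/
lemma mem_outerUnitNormals_of_tendsto {κ : ℕ → ConvexBody (Euc 2)} {K : ConvexBody (Euc 2)}
    (hκ : Tendsto κ atTop (𝓝 K)) {z : ℕ → Euc 2 × Euc 2} {s n : Euc 2}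
    (hz : Tendsto z atTop (𝓝 (s, n)))
    (hmem : ∀ᶠ k in atTop, (z k).1 ∈ κ k ∧ (z k).2 ∈ outerUnitNormals (κ k) (z k).1) :
    s ∈ K ∧ n ∈ outerUnitNormals K s := by
  have hs : Tendsto (fun k => (z k).1) atTop (𝓝 s) := (continuous_fst.tendsto _).comp hz
  have hn : Tendsto (fun k => (z k).2) atTop (𝓝 n) := (continuous_snd.tendsto _).comp hz
  have hd : Tendsto (fun k => dist (κ k) K) atTop (𝓝 0) := tendsto_iff_dist_tendsto_zero.1 hκ
  refine ⟨?_, ?_, fun y hy => ?_⟩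
  · have h1 : Metric.infDist s (K : Set (Euc 2)) ≤ 0 := by
      refine le_of_tendsto_of_tendsto (((Metric.continuous_infDist_pt _).tendsto s).comp hs) hd ?_
      filter_upwards [hmem] with k hk
      exact Metric.infDist_le_hausdorffDist_of_mem hk.1 ConvexBody.hausdorffEDist_ne_top
    have h2 := (K.isClosed.mem_iff_infDist_zero K.nonempty).2 (le_antisymm h1 Metric.infDist_nonneg)
    exact h2
  · refine tendsto_nhds_unique hn.norm (tendsto_const_nhds.congr' ?_)
    filter_upwards [hmem] with k hk using hk.2.1.symm
  · refine le_of_tendsto_of_tendsto ((hs.const_sub y).inner hn) hd ?_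
    filter_upwards [hmem] with k hk
    obtain ⟨y', hy', hdist⟩ := ConvexBody.exists_dist_le K (κ k) hy
    have h1 := hk.2.2 y' hy'
    have h2 : inner ℝ (y - (z k).1) (z k).2 =
        inner ℝ (y - y') (z k).2 + inner ℝ (y' - (z k).1) (z k).2 := by
      rw [← inner_add_left, sub_add_sub_cancel]
    have h3 := real_inner_le_norm (y - y') (z k).2
    rw [hk.2.1, mul_one, ← dist_eq_norm] at h3
    rw [dist_comm (κ k) K, h2]
    linarith

lemma eventually_forall_norm_le {κ : ℕ → ConvexBody (Euc 2)} {K : ConvexBody (Euc 2)}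
    (hκ : Tendsto κ atTop (𝓝 K)) : ∃ R, ∀ᶠ k in atTop, ∀ s ∈ κ k, ‖s‖ ≤ R := by
  obtain ⟨R, hR⟩ := K.exists_norm_le
  refine ⟨R + 1, ?_⟩
  filter_upwards [hκ (Metric.ball_mem_nhds K one_pos)] with k hk s hs
  obtain ⟨y, hy, hd⟩ := ConvexBody.exists_dist_le (κ k) K hs
  have hk' : dist (κ k) K < 1 := hk
  have h1 := norm_le_norm_add_norm_sub y s
  rw [norm_sub_rev, ← dist_eq_norm] at h1
  rw [dist_comm] at h1
  have := hR y hy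
  rw [dist_comm] at hd
  linarith

lemma tendsto_slice_of_notMem {κ : ℕ → ConvexBody (Euc 2)} {K : ConvexBody (Euc 2)}
    (hκ : Tendsto κ atTop (𝓝 K)) (G : Euc 2 → Euc 2 → ℝ) {u : Euc 2} (hu : ‖u‖ = 1) {t : ℝ}
    (ht : t ∉ (fun s => inner ℝ s (quarterTurn u)) '' (K : Set (Euc 2))) :
    Tendsto (fun k => slice G (κ k) u t) atTop (𝓝 (slice G K u t)) := by
  have hcl : IsClosed ((fun s => inner ℝ s (quarterTurn u)) '' (K : Set (Euc 2))) :=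
    (K.isCompact.image (by fun_prop)).isClosed
  obtain ⟨δ, hδ, hball⟩ := Metric.isOpen_iff.1 hcl.isOpen_compl t ht
  have h0 : ∀ L : ConvexBody (Euc 2), dist L K < δ → slice G L u t = 0 := by
    intro L hL
    refine slice_eq_zero G ?_
    rintro ⟨s, hs, rfl⟩
    obtain ⟨y, hy, hd⟩ := ConvexBody.exists_dist_le L K hs.1.1
    refine hball (a := inner ℝ y (quarterTurn u)) ?_ ⟨y, hy, rfl⟩
    rw [Metric.mem_ball, Real.dist_eq, ← inner_sub_left]
    refine (abs_inner_quarterTurn_le hu).trans_lt ?_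
    rw [← dist_eq_norm, dist_comm]
    exact hd.trans_lt hL
  rw [h0 K (by simpa using hδ)]
  refine tendsto_const_nhds.congr' ?_
  filter_upwards [hκ (Metric.ball_mem_nhds K hδ)] with k hk using (h0 _ hk).symm

/-- For large k there is a visible pair (point, normal) of κ k over t. These pairs stay in a compact
set, and each of their cluster points is a visible pair of K over t; there is only one such pair, so
they converge to it. -/
lemma tendsto_slice_of_mem_interior {κ : ℕ → ConvexBody (Euc 2)} {K : ConvexBody (Euc 2)}
    (hκ : Tendsto κ atTop (𝓝 K)) {G : Euc 2 → Euc 2 → ℝ}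
    (hG : Continuous fun z : Euc 2 × Euc 2 => G z.1 z.2) {u : Euc 2} (hu : ‖u‖ = 1) {t : ℝ}
    (ht : t ∈ interior ((fun s => inner ℝ s (quarterTurn u)) '' (K : Set (Euc 2))))
    (hK : t ∉ (fun s => inner ℝ s (quarterTurn u)) '' irregularPoints K)
    (hκi : ∀ k, t ∉ (fun s => inner ℝ s (quarterTurn u)) '' irregularPoints (κ k)) :
    Tendsto (fun k => slice G (κ k) u t) atTop (𝓝 (slice G K u t)) := by
  obtain ⟨δ, hδ, hball⟩ := Metric.isOpen_iff.1 isOpen_interior t ht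
  obtain ⟨y, hy, hyt⟩ := interior_subset (hball (a := t - δ / 2) (by
    rw [Metric.mem_ball, Real.dist_eq, abs_lt]; constructor <;> linarith))
  obtain ⟨z, hz, hzt⟩ := interior_subset (hball (a := t + δ / 2) (by
    rw [Metric.mem_ball, Real.dist_eq, abs_lt]; constructor <;> linarith))
  simp only at hyt hzt
  have hmem : ∀ L : ConvexBody (Euc 2),
      t ∉ (fun s => inner ℝ s (quarterTurn u)) '' irregularPoints L → dist K L < δ / 2 →
      ∃ w : Euc 2 × Euc 2, w.1 ∈ visiblePoints L u ∧ inner ℝ w.1 (quarterTurn u) = t ∧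
        w.2 = visibleNormal L u w.1 := by
    intro L hLi hL
    obtain ⟨y', hy', hyd⟩ := ConvexBody.exists_dist_le K L hy
    obtain ⟨z', hz', hzd⟩ := ConvexBody.exists_dist_le K L hz
    have h1 := abs_inner_quarterTurn_le (s := y - y') hu
    have h2 := abs_inner_quarterTurn_le (s := z - z') hu
    rw [inner_sub_left, ← dist_eq_norm] at h1 h2
    obtain ⟨s, hs, hst, n, hn, hun⟩ := exists_normal_of_lt (t := t) hu hy' hz'
      (by linarith [(abs_le.1 h1).1]) (by linarith [(abs_le.1 h2).2])
    exact ⟨(s, visibleNormal L u s), ⟨⟨hs, n, hn, hun⟩, fun hi => hLi ⟨s, hi, hst⟩⟩, hst, rfl⟩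
  obtain ⟨⟨s, n⟩, hs, hst, hn⟩ := hmem K hK (by simpa using hδ)
  simp only at hs hst hn
  have hev : ∀ᶠ k in atTop, ∃ w : Euc 2 × Euc 2, w.1 ∈ visiblePoints (κ k) u ∧
      inner ℝ w.1 (quarterTurn u) = t ∧ w.2 = visibleNormal (κ k) u w.1 := by
    filter_upwards [hκ (Metric.ball_mem_nhds K (half_pos hδ))] with k hk
    refine hmem _ (hκi k) ?_
    rw [dist_comm]; exact hk
  obtain ⟨w, hw⟩ := hev.choice
  obtain ⟨R, hR⟩ := eventually_forall_norm_le hκ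
  have hlim : Tendsto w atTop (𝓝 (s, n)) := by
    refine ((isCompact_closedBall (0 : Euc 2) R).prod
      (isCompact_sphere (0 : Euc 2) 1)).tendsto_nhds_of_unique_mapClusterPt ?_ ?_
    · filter_upwards [hw, hR] with k hk hRk
      refine ⟨by simpa using hRk _ hk.1.1.1, ?_⟩
      rw [hk.2.2]
      simpa using (visibleNormal_mem hk.1).1
    · rintro ⟨s', n'⟩ - hcl
      obtain ⟨ψ, hψ, hψlim⟩ := hcl.tendsto_subseq
      have hwψ := hψ.tendsto_atTop.eventually hw
      obtain ⟨hs', hn'⟩ := mem_outerUnitNormals_of_tendsto (hκ.comp hψ.tendsto_atTop) hψlim (by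
        filter_upwards [hwψ] with k hk
        refine ⟨hk.1.1.1, ?_⟩
        simp only [Function.comp_apply]
        rw [hk.2.2]
        exact visibleNormal_mem hk.1)
      have hst' : inner ℝ s' (quarterTurn u) = t := by
        have h1 : Tendsto (fun k => inner ℝ ((w ∘ ψ) k).1 (quarterTurn u)) atTop
            (𝓝 (inner ℝ s' (quarterTurn u))) :=
          ((continuous_fst.tendsto _).comp hψlim).inner tendsto_const_nhds
        refine tendsto_nhds_unique h1 (tendsto_const_nhds.congr' ?_)
        filter_upwards [hwψ] with k hk using hk.2.1.symm
      have hun' : 0 ≤ inner ℝ u n' := by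
        have h1 : Tendsto (fun k => inner ℝ u ((w ∘ ψ) k).2) atTop (𝓝 (inner ℝ u n')) :=
          tendsto_const_nhds.inner ((continuous_snd.tendsto _).comp hψlim)
        refine ge_of_tendsto h1 ?_
        filter_upwards [hwψ] with k hk
        simp only [Function.comp_apply]
        rw [hk.2.2]
        exact (inner_visibleNormal_pos hk.1).le
      have hpos := inner_pos_of_mem_outerUnitNormals hu hn' hun' hy hz
        (by rw [hst']; linarith) (by rw [hst']; linarith)
      have hvis : s' ∈ visiblePoints K u :=
        ⟨⟨hs', n', hn', hpos⟩, fun hi => hK ⟨s', hi, hst'⟩⟩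
      have hss : s' = s := injOn_visiblePoints K hu hvis hs (hst'.trans hst.symm)
      subst hss
      rw [hn, visibleNormal_eq hvis hn' hpos]
  have hval : ∀ (L : ConvexBody (Euc 2)) (w : Euc 2 × Euc 2), w.1 ∈ visiblePoints L u →
      inner ℝ w.1 (quarterTurn u) = t → w.2 = visibleNormal L u w.1 →
      slice G L u t = G w.1 w.2 := by
    rintro L w h1 rfl h3
    rw [slice_inner G hu h1, h3]
  rw [hval K (s, n) hs hst hn]
  refine ((hG.tendsto (s, n)).comp hlim).congr' ?_
  filter_upwards [hw] with k hk
  exact (hval (κ k) (w k) hk.1 hk.2.1 hk.2.2).symm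

lemma volume_image_irregularPoints (K : ConvexBody (Euc 2)) (u : Euc 2) :
    volume ((fun s => inner ℝ s (quarterTurn u)) '' irregularPoints K) = 0 :=
  ((countable_irregularPoints K).image _).measure_zero _

lemma volume_frontier_image (K : ConvexBody (Euc 2)) (u : Euc 2) :
    volume (frontier ((fun s => inner ℝ s (quarterTurn u)) '' (K : Set (Euc 2)))) = 0 := by
  refine Convex.addHaar_frontier volume (K.convex.is_linear_image ⟨fun x y => ?_, fun c x => ?_⟩)
  · exact inner_add_left _ _ _
  · exact real_inner_smul_left _ _ _

/-- Pointwise convergence may fail only at the frontier of the projection of K and at projections of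
irregular points of K and of all the κ k. These form a null set because the sequence is countable.
-/
lemma tendsto_integral_slice {κ : ℕ → ConvexBody (Euc 2)} {K : ConvexBody (Euc 2)}
    (hκ : Tendsto κ atTop (𝓝 K)) {G : Euc 2 → Euc 2 → ℝ}
    (hG : Continuous fun z : Euc 2 × Euc 2 => G z.1 z.2) {u : Euc 2} (hu : ‖u‖ = 1) :
    Tendsto (fun k => ∫ t, slice G (κ k) u t) atTop (𝓝 (∫ t, slice G K u t)) := by
  obtain ⟨R, hR⟩ := eventually_forall_norm_le hκ
  obtain ⟨C, hC⟩ := exists_bound_of_continuous hG R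
  refine tendsto_integral_filter_of_dominated_convergence
    ((Icc (-R) R).indicator (fun _ => C)) ?_ ?_ ?_ ?_
  · exact Eventually.of_forall fun k => (measurable_slice hG _ hu).aestronglyMeasurable
  · filter_upwards [hR] with k hk
    exact Eventually.of_forall fun t => abs_slice_le hu hk hC t
  · exact (integrable_indicator_iff measurableSet_Icc).2 (integrableOn_const (by simp))
  · have h1 := measure_eq_zero_iff_ae_notMem.1 (volume_frontier_image K u)
    have h2 := measure_eq_zero_iff_ae_notMem.1 (volume_image_irregularPoints K u)
    have h3 := ae_all_iff.2 fun k =>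
      measure_eq_zero_iff_ae_notMem.1 (volume_image_irregularPoints (κ k) u)
    filter_upwards [h1, h2, h3] with t ht1 ht2 ht3
    by_cases ht : t ∈ (fun s => inner ℝ s (quarterTurn u)) '' (K : Set (Euc 2))
    · refine tendsto_slice_of_mem_interior hκ hG hu (by_contra fun hi => ht1 ?_) ht2 ht3
      exact ⟨subset_closure ht, hi⟩
    · exact tendsto_slice_of_notMem hκ G hu ht

theorem continuous_boundaryIntegral {F : Euc 2 → Euc 2 → ℝ}
    (hF : Continuous fun z : Euc 2 × Euc 2 => F z.1 z.2) : Continuous (boundaryIntegral F) := by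
  rw [continuous_iff_seqContinuous]
  intro κ K hκ
  simp only [Function.comp_def, boundaryIntegral_eq_sum_slice hF]
  exact tendsto_finsetSum _ fun i _ => tendsto_integral_slice hκ
    (G := fun s n => F s n * max 0 (inner ℝ (axisDirection i) n)) (by fun_prop)
    (norm_axisDirection i)

/-! ### Vanishing integrals -/

/-- Almost every line parallel to u that meets K carries a visible point, so a kernel depending only
on the transverse coordinate does not see the shape of the boundary. -/
lemma slice_ae_eq_indicator (φ : ℝ → ℝ) (K : ConvexBody (Euc 2)) {u : Euc 2} (hu : ‖u‖ = 1) :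
    slice (fun s _ => φ (inner ℝ s (quarterTurn u))) K u =ᵐ[volume]
      ((fun s => inner ℝ s (quarterTurn u)) '' (K : Set (Euc 2))).indicator φ := by
  have h1 := measure_eq_zero_iff_ae_notMem.1 (volume_frontier_image K u)
  have h2 := measure_eq_zero_iff_ae_notMem.1 (volume_image_irregularPoints K u)
  filter_upwards [h1, h2] with t ht1 ht2
  by_cases ht : t ∈ (fun s => inner ℝ s (quarterTurn u)) '' (K : Set (Euc 2))
  · rw [indicator_of_mem ht]
    have hi : t ∈ interior ((fun s => inner ℝ s (quarterTurn u)) '' (K : Set (Euc 2))) :=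
      by_contra fun hi => ht1 ⟨subset_closure ht, hi⟩
    obtain ⟨δ, hδ, hball⟩ := Metric.isOpen_iff.1 isOpen_interior t hi
    obtain ⟨y, hy, hyt⟩ := interior_subset (hball (a := t - δ / 2) (by
      rw [Metric.mem_ball, Real.dist_eq, abs_lt]; constructor <;> linarith))
    obtain ⟨z, hz, hzt⟩ := interior_subset (hball (a := t + δ / 2) (by
      rw [Metric.mem_ball, Real.dist_eq, abs_lt]; constructor <;> linarith))
    simp only at hyt hzt
    obtain ⟨s, hs, rfl, n, hn, hun⟩ := exists_normal_of_lt (t := t) hu hy hz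
      (by linarith) (by linarith)
    exact slice_inner _ hu ⟨⟨hs, n, hn, hun⟩, fun hi => ht2 ⟨s, hi, rfl⟩⟩
  · rw [indicator_of_notMem ht]
    exact slice_eq_zero _ fun h => ht (image_mono (visiblePoints_subset K u) h)

lemma quarterTurn_neg (u : Euc 2) : quarterTurn (-u) = -quarterTurn u :=
  euc_two_ext (by simp) (by simp)

/-- The projections of `K` from two opposite sides cancel. -/
theorem boundaryIntegral_inner_eq_zero {φ : ℝ → ℝ} (hφ : Continuous φ) (K : ConvexBody (Euc 2))
    {u : Euc 2} (hu : ‖u‖ = 1) :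
    boundaryIntegral (fun s n => φ (inner ℝ s (quarterTurn u)) * inner ℝ u n) K = 0 := by
  have hu' : ‖-u‖ = 1 := by rwa [norm_neg]
  have hc : Continuous fun z : Euc 2 × Euc 2 => φ (inner ℝ z.1 (quarterTurn u)) := by fun_prop
  have h1 : boundaryIntegral
      (fun s n => φ (inner ℝ s (quarterTurn u)) * max 0 (inner ℝ u n)) K =
      ∫ t in (fun s => inner ℝ s (quarterTurn u)) '' (K : Set (Euc 2)), φ t := by
    rw [boundaryIntegral, integral_normalSum_posPart
      (G := fun s _ => φ (inner ℝ s (quarterTurn u))) hc K hu,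
      integral_congr_ae (slice_ae_eq_indicator φ K hu), integral_indicator]
    exact (K.isCompact.image (by fun_prop)).measurableSet
  have h2 : boundaryIntegral
      (fun s n => φ (inner ℝ s (quarterTurn u)) * max 0 (inner ℝ (-u) n)) K =
      ∫ t in (fun s => inner ℝ s (quarterTurn u)) '' (K : Set (Euc 2)), φ t := by
    -- Seen from -u the transverse coordinate changes sign, so φ is composed with t ↦ -t; the
    -- reflection of the line undoes this below.
    have h3 := slice_ae_eq_indicator (fun t => φ (-t)) K hu'
    simp only [quarterTurn_neg, inner_neg_right, neg_neg] at h3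
    rw [boundaryIntegral, integral_normalSum_posPart
      (G := fun s _ => φ (inner ℝ s (quarterTurn u))) hc K hu', integral_congr_ae h3,
      ← integral_neg_eq_self, ← integral_indicator (K.isCompact.image (by fun_prop)).measurableSet]
    refine integral_congr_ae (Eventually.of_forall fun t => ?_)
    have h5 : -t ∈ (fun a => -inner ℝ a (quarterTurn u)) '' (K : Set (Euc 2)) ↔
        t ∈ (fun s => inner ℝ s (quarterTurn u)) '' (K : Set (Euc 2)) := by
      constructor
      · rintro ⟨s, hs, hst⟩
        exact ⟨s, hs, neg_injective hst⟩
      · rintro ⟨s, hs, rfl⟩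
        exact ⟨s, hs, rfl⟩
    beta_reduce
    by_cases ht : t ∈ (fun s => inner ℝ s (quarterTurn u)) '' (K : Set (Euc 2))
    · rw [indicator_of_mem ht, indicator_of_mem (h5.2 ht), neg_neg]
    · rw [indicator_of_notMem ht, indicator_of_notMem (mt h5.1 ht)]
  have h4 : boundaryIntegral (fun s n => φ (inner ℝ s (quarterTurn u)) * inner ℝ u n) K =
      boundaryIntegral (fun s n => φ (inner ℝ s (quarterTurn u)) * max 0 (inner ℝ u n) +
        (-1) * (φ (inner ℝ s (quarterTurn u)) * max 0 (inner ℝ (-u) n))) K := by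
    refine boundaryIntegral_congr fun s n _ => ?_
    rw [inner_neg_left]
    rcases le_total 0 (inner ℝ u n) with h | h
    · rw [max_eq_right h, max_eq_left (by linarith)]; ring
    · rw [max_eq_left h, max_eq_right (by linarith)]; ring
  rw [h4, boundaryIntegral_add (by fun_prop) (by fun_prop), boundaryIntegral_const_mul, h1, h2]
  ring

/-! ### Rigid motions -/

lemma outerUnitNormals_translateBody (K : ConvexBody (Euc 2)) (x s : Euc 2) :
    outerUnitNormals (translateBody K x) (s + x) = outerUnitNormals K s := by
  ext n
  refine and_congr_right fun _ => ⟨fun h y hy => ?_, ?_⟩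
  · simpa using h (y + x) ⟨y, hy, rfl⟩
  · rintro h _ ⟨y, hy, rfl⟩
    simpa using h y hy

lemma boundaryIntegral_translateBody (F : Euc 2 → Euc 2 → ℝ) (K : ConvexBody (Euc 2))
    (x : Euc 2) :
    boundaryIntegral F (translateBody K x) = boundaryIntegral (fun s n => F (s + x) n) K := by
  have := ((IsometryEquiv.addRight x).measurePreserving_hausdorffMeasure 1).setIntegral_image_emb
    (IsometryEquiv.addRight x).toHomeomorph.measurableEmbedding (normalSum F (translateBody K x))
    (K : Set (Euc 2))
  refine this.trans (integral_congr_ae (Eventually.of_forall fun s => ?_))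
  simp only [IsometryEquiv.addRight_apply, normalSum, outerUnitNormals_translateBody]

lemma outerUnitNormals_rotateBody (U : Euc 2 ≃ₗᵢ[ℝ] Euc 2) (K : ConvexBody (Euc 2)) (s : Euc 2) :
    outerUnitNormals (rotateBody U K) (U s) = U '' outerUnitNormals K s := by
  ext n
  constructor
  · rintro ⟨hn, h⟩
    refine ⟨U.symm n, ⟨by simpa using hn, fun y hy => ?_⟩, by simp⟩
    have := h (U y) ⟨y, hy, rfl⟩
    rwa [← map_sub, ← U.apply_symm_apply n, U.inner_map_map] at this
  · rintro ⟨n, ⟨hn, h⟩, rfl⟩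
    refine ⟨by simpa using hn, ?_⟩
    rintro _ ⟨y, hy, rfl⟩
    rw [← map_sub, U.inner_map_map]
    exact h y hy

lemma boundaryIntegral_rotateBody (F : Euc 2 → Euc 2 → ℝ) (U : Euc 2 ≃ₗᵢ[ℝ] Euc 2)
    (K : ConvexBody (Euc 2)) :
    boundaryIntegral F (rotateBody U K) = boundaryIntegral (fun s n => F (U s) (U n)) K := by
  have := (U.toIsometryEquiv.measurePreserving_hausdorffMeasure 1).setIntegral_image_emb
    U.toHomeomorph.measurableEmbedding (normalSum F (rotateBody U K)) (K : Set (Euc 2))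
  refine this.trans (integral_congr_ae (Eventually.of_forall fun s => ?_))
  change normalSum F (rotateBody U K) (U s) = _
  rw [normalSum, outerUnitNormals_rotateBody, finsum_mem_image U.injective.injOn]
  rfl

/-! ### The valuation property -/

lemma outerUnitNormals_of_union {K₁ K₂ L : ConvexBody (Euc 2)}
    (hL : (L : Set (Euc 2)) = (K₁ : Set (Euc 2)) ∪ (K₂ : Set (Euc 2))) (s : Euc 2) :
    outerUnitNormals L s = outerUnitNormals K₁ s ∩ outerUnitNormals K₂ s := by
  have hmem : ∀ y, y ∈ L ↔ y ∈ K₁ ∨ y ∈ K₂ := fun y => by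
    rw [← SetLike.mem_coe, hL]; rfl
  ext n
  constructor
  · rintro ⟨h1, h2⟩
    exact ⟨⟨h1, fun y hy => h2 y ((hmem y).2 (Or.inl hy))⟩,
      ⟨h1, fun y hy => h2 y ((hmem y).2 (Or.inr hy))⟩⟩
  · rintro ⟨⟨h1, h2⟩, ⟨-, h3⟩⟩
    exact ⟨h1, fun y hy => ((hmem y).1 hy).elim (h2 y) (h3 y)⟩

/-- If n fails for both bodies, there are y ∈ K₁ and z ∈ K₂ strictly beyond the line through s.
Their segment lies in the convex union, so by connectedness it meets the intersection, again
strictly beyond the line. -/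
lemma outerUnitNormals_of_inter {K₁ K₂ L M : ConvexBody (Euc 2)}
    (hL : (L : Set (Euc 2)) = (K₁ : Set (Euc 2)) ∪ (K₂ : Set (Euc 2)))
    (hM : (M : Set (Euc 2)) = (K₁ : Set (Euc 2)) ∩ (K₂ : Set (Euc 2))) (s : Euc 2) :
    outerUnitNormals M s = outerUnitNormals K₁ s ∪ outerUnitNormals K₂ s := by
  have hmem : ∀ y, y ∈ M ↔ y ∈ K₁ ∧ y ∈ K₂ := fun y => by
    rw [← SetLike.mem_coe, hM]; rfl
  ext n
  constructor
  · rintro ⟨hn, h⟩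
    by_contra hnot
    simp only [mem_union, not_or] at hnot
    obtain ⟨y, hy, hyn⟩ : ∃ y ∈ K₁, 0 < inner ℝ (y - s) n := by
      by_contra! hle; exact hnot.1 ⟨hn, hle⟩
    obtain ⟨z, hz, hzn⟩ : ∃ z ∈ K₂, 0 < inner ℝ (z - s) n := by
      by_contra! hle; exact hnot.2 ⟨hn, hle⟩
    have hseg : segment ℝ y z ⊆ (K₁ : Set (Euc 2)) ∪ K₂ := by
      rw [← hL]
      refine L.convex.segment_subset ?_ ?_
      · rw [hL]; exact Or.inl hy
      · rw [hL]; exact Or.inr hz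
    obtain ⟨w, hw, hw1, hw2⟩ := isPreconnected_closed_iff.1
      (convex_segment y z).isPreconnected _ _ K₁.isClosed K₂.isClosed hseg
      ⟨y, left_mem_segment ℝ y z, hy⟩ ⟨z, right_mem_segment ℝ y z, hz⟩
    have hpos : 0 < inner ℝ (w - s) n := by
      obtain ⟨a, b, ha, hb, hab, rfl⟩ := hw
      have : a • y + b • z - s = a • (y - s) + b • (z - s) := by
        have : s = (a + b) • s := by rw [hab, one_smul]
        conv_lhs => rw [this]
        module
      rw [this, inner_add_left, real_inner_smul_left, real_inner_smul_left]
      rcases ha.eq_or_lt with rfl | ha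
      · rw [zero_add] at hab; subst hab; simpa using hzn
      · have := mul_pos ha hyn
        have := mul_nonneg hb hzn.le
        linarith
    exact absurd (h w ((hmem w).2 ⟨hw1, hw2⟩)) (not_le.2 hpos)
  · rintro (⟨h1, h2⟩ | ⟨h1, h2⟩)
    · exact ⟨h1, fun y hy => h2 y ((hmem y).1 hy).1⟩
    · exact ⟨h1, fun y hy => h2 y ((hmem y).1 hy).2⟩

/-- Normality is a local condition on a convex set: points of the segment from s to y ∈ K₂ close to
s lie in the union but not in K₂, hence in K₁. -/
lemma outerUnitNormals_of_notMem {K₁ K₂ L : ConvexBody (Euc 2)}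
    (hL : (L : Set (Euc 2)) = (K₁ : Set (Euc 2)) ∪ (K₂ : Set (Euc 2))) {s : Euc 2}
    (hs : s ∈ K₁) (hs' : s ∉ K₂) : outerUnitNormals L s = outerUnitNormals K₁ s := by
  rw [outerUnitNormals_of_union hL, inter_eq_left]
  rintro n ⟨hn, h⟩
  refine ⟨hn, fun y hy => ?_⟩
  have hc : Tendsto (fun ε : ℝ => s + ε • (y - s)) (𝓝[>] 0) (𝓝 s) := by
    have : Continuous (fun ε : ℝ => s + ε • (y - s)) := by fun_prop
    simpa using (this.tendsto 0).mono_left nhdsWithin_le_nhds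
  have h1 := hc.eventually (K₂.isClosed.isOpen_compl.mem_nhds hs')
  have h2 : ∀ᶠ ε : ℝ in 𝓝[>] 0, ε < 1 :=
    (gt_mem_nhds one_pos).filter_mono nhdsWithin_le_nhds
  obtain ⟨ε, ⟨hε1, hε2⟩, hε : 0 < ε⟩ := ((h1.and h2).and self_mem_nhdsWithin).exists
  have hmem : s + ε • (y - s) ∈ (L : Set (Euc 2)) := by
    refine L.convex.add_smul_sub_mem ?_ ?_ ⟨hε.le, hε2.le⟩
    · rw [hL]; exact Or.inl hs
    · rw [hL]; exact Or.inr hy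
  rw [hL] at hmem
  have h3 := h _ (hmem.resolve_right hε1)
  rw [add_sub_cancel_left, real_inner_smul_left] at h3
  by_contra! h4
  have := mul_pos hε h4
  linarith

theorem isValuation_boundaryIntegral {F : Euc 2 → Euc 2 → ℝ}
    (hF : Continuous fun z : Euc 2 × Euc 2 => F z.1 z.2) : IsValuation (boundaryIntegral F) := by
  intro K₁ K₂ L M hL hM
  have hint : ∀ K : ConvexBody (Euc 2), Integrable ((K : Set (Euc 2)).indicator (normalSum F K))
      (Measure.hausdorffMeasure 1) := fun K =>
    (integrable_indicator_iff K.isClosed.measurableSet).2 (integrableOn_normalSum hF K)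
  simp only [boundaryIntegral]
  simp only [← integral_indicator (ConvexBody.isClosed _).measurableSet]
  rw [← integral_add (hint _) (hint _), ← integral_add (hint _) (hint _)]
  refine integral_congr_ae ?_
  -- Regularity for K₁ and K₂ makes both sets of normals finite, as inclusion-exclusion for `finsum`
  -- requires.
  filter_upwards [ae_notMem_irregularPoints K₁ _ le_rfl, ae_notMem_irregularPoints K₂ _ le_rfl]
    with s hs1 hs2
  have hLmem : s ∈ (L : Set (Euc 2)) ↔ s ∈ (K₁ : Set (Euc 2)) ∨ s ∈ (K₂ : Set (Euc 2)) := by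
    rw [hL]; rfl
  have hMmem : s ∈ (M : Set (Euc 2)) ↔ s ∈ (K₁ : Set (Euc 2)) ∧ s ∈ (K₂ : Set (Euc 2)) := by
    rw [hM]; rfl
  by_cases h1 : s ∈ (K₁ : Set (Euc 2)) <;> by_cases h2 : s ∈ (K₂ : Set (Euc 2))
  · rw [indicator_of_mem (hLmem.2 (Or.inl h1)), indicator_of_mem (hMmem.2 ⟨h1, h2⟩),
      indicator_of_mem h1, indicator_of_mem h2]
    simp only [normalSum]
    rw [outerUnitNormals_of_inter hL hM, outerUnitNormals_of_union hL, add_comm]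
    exact finsum_mem_union_inter (finite_outerUnitNormals h1 hs1) (finite_outerUnitNormals h2 hs2)
  · rw [indicator_of_mem (hLmem.2 (Or.inl h1)), indicator_of_notMem (fun h => h2 (hMmem.1 h).2),
      indicator_of_mem h1, indicator_of_notMem h2]
    simp only [normalSum]
    rw [outerUnitNormals_of_notMem hL h1 h2]
  · rw [indicator_of_mem (hLmem.2 (Or.inr h2)), indicator_of_notMem (fun h => h1 (hMmem.1 h).1),
      indicator_of_notMem h1, indicator_of_mem h2]
    simp only [normalSum]
    rw [union_comm] at hL
    rw [outerUnitNormals_of_notMem hL h2 h1]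
    ring
  · rw [indicator_of_notMem (fun h => (hLmem.1 h).elim h1 h2),
      indicator_of_notMem (fun h => h2 (hMmem.1 h).2),
      indicator_of_notMem h1, indicator_of_notMem h2]

/-! ### Orthogonal transformations of the plane -/

lemma det_euc_two (U : Euc 2 →ₗ[ℝ] Euc 2) :
    LinearMap.det U = U !₂[1, 0] 0 * U !₂[0, 1] 1 - U !₂[1, 0] 1 * U !₂[0, 1] 0 := by
  have h0 : (PiLp.basisFun 2 ℝ (Fin 2)) 0 = !₂[(1 : ℝ), 0] :=
    euc_two_ext (by simp) (by simp)
  have h1 : (PiLp.basisFun 2 ℝ (Fin 2)) 1 = !₂[(0 : ℝ), 1] :=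
    euc_two_ext (by simp) (by simp)
  rw [← LinearMap.det_toMatrix (PiLp.basisFun 2 ℝ (Fin 2)), Matrix.det_fin_two]
  simp only [LinearMap.toMatrix_apply, h0, h1, PiLp.basisFun_repr]
  ring

lemma linearIsometry_relations (U : Euc 2 ≃ₗᵢ[ℝ] Euc 2) :
    (U !₂[1, 0] 0 ^ 2 + U !₂[1, 0] 1 ^ 2 = 1 ∧ U !₂[0, 1] 0 ^ 2 + U !₂[0, 1] 1 ^ 2 = 1) ∧
      U !₂[1, 0] 0 * U !₂[0, 1] 0 + U !₂[1, 0] 1 * U !₂[0, 1] 1 = 0 := by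
  refine ⟨⟨?_, ?_⟩, ?_⟩
  · rw [← norm_sq_euc_two, U.norm_map, norm_sq_euc_two]; simp
  · rw [← norm_sq_euc_two, U.norm_map, norm_sq_euc_two]; simp
  · rw [← inner_euc_two, U.inner_map_map, inner_euc_two]; simp

lemma det_linearIsometry_sq (U : Euc 2 ≃ₗᵢ[ℝ] Euc 2) :
    LinearMap.det (U.toLinearEquiv : Euc 2 →ₗ[ℝ] Euc 2) ^ 2 = 1 := by
  obtain ⟨⟨h1, h2⟩, h3⟩ := linearIsometry_relations U
  rw [det_euc_two]
  simp only [LinearEquiv.coe_coe, LinearIsometryEquiv.coe_toLinearEquiv]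
  linear_combination h1 * (U !₂[0, 1] 0 ^ 2 + U !₂[0, 1] 1 ^ 2) + h2 -
    (U !₂[1, 0] 0 * U !₂[0, 1] 0 + U !₂[1, 0] 1 * U !₂[0, 1] 1) * h3

lemma quarterTurn_linearIsometry (U : Euc 2 ≃ₗᵢ[ℝ] Euc 2) (v : Euc 2) :
    quarterTurn (U v) =
      LinearMap.det (U.toLinearEquiv : Euc 2 →ₗ[ℝ] Euc 2) • U (quarterTurn v) := by
  obtain ⟨⟨h1, h2⟩, h3⟩ := linearIsometry_relations U
  have hexp : ∀ w : Euc 2, U w = w 0 • U !₂[1, 0] + w 1 • U !₂[0, 1] := fun w => by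
    rw [← map_smul, ← map_smul, ← map_add]
    congr 1
    exact euc_two_ext (by simp) (by simp)
  rw [det_euc_two, hexp v, hexp (quarterTurn v)]
  simp only [LinearEquiv.coe_coe, LinearIsometryEquiv.coe_toLinearEquiv]
  set a := U !₂[1, 0]
  set b := U !₂[0, 1]
  refine euc_two_ext ?_ ?_ <;>
    simp only [quarterTurn_zero, quarterTurn_one, PiLp.add_apply, PiLp.smul_apply, smul_eq_mul]
  · linear_combination -v 0 * (b 1 * h3 - a 1 * h2) + v 1 * (b 1 * h1 - a 1 * h3)
  · linear_combination -v 0 * (a 0 * h2 - b 0 * h3) + v 1 * (a 0 * h3 - b 0 * h1)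

/-! ### Polynomial behaviour under translations -/

lemma continuous_coeff_mul {Z : Type*} [TopologicalSpace Z] {A B : Z → MvPolynomial (Fin 2) ℝ}
    (hA : ∀ m, Continuous fun z => (A z).coeff m) (hB : ∀ m, Continuous fun z => (B z).coeff m)
    (m : Fin 2 →₀ ℕ) : Continuous fun z => (A z * B z).coeff m := by
  simp only [MvPolynomial.coeff_mul]
  exact continuous_finsetSum _ fun i _ => (hA _).mul (hB _)

lemma continuous_coeff_pow {Z : Type*} [TopologicalSpace Z] {A : Z → MvPolynomial (Fin 2) ℝ}
    (hA : ∀ m, Continuous fun z => (A z).coeff m) (k : ℕ) :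
    ∀ m, Continuous fun z => (A z ^ k).coeff m := by
  classical
  induction k with
  | zero => intro m; simp only [pow_zero]; exact continuous_const
  | succ k ih => simp only [pow_succ]; exact continuous_coeff_mul ih hA

lemma continuous_coeff_affine {Z : Type*} [TopologicalSpace Z] {a b c : Z → ℝ}
    (ha : Continuous a) (hb : Continuous b) (hc : Continuous c) (m : Fin 2 →₀ ℕ) :
    Continuous fun z => (MvPolynomial.C (a z) + (MvPolynomial.C (b z) * MvPolynomial.X 0 +
      MvPolynomial.C (c z) * MvPolynomial.X 1) : MvPolynomial (Fin 2) ℝ).coeff m := by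
  classical
  simp only [MvPolynomial.coeff_add, MvPolynomial.coeff_C_mul]
  refine Continuous.add ?_ ((hb.mul continuous_const).add (hc.mul continuous_const))
  simp only [MvPolynomial.coeff_C]
  split_ifs
  · exact ha
  · exact continuous_const

lemma totalDegree_affine_le (a b c : ℝ) :
    (MvPolynomial.C a + (MvPolynomial.C b * MvPolynomial.X 0 +
      MvPolynomial.C c * MvPolynomial.X 1) : MvPolynomial (Fin 2) ℝ).totalDegree ≤ 1 := by
  have h : ∀ (r : ℝ) (i : Fin 2),
      (MvPolynomial.C r * MvPolynomial.X i : MvPolynomial (Fin 2) ℝ).totalDegree ≤ 1 := fun r i =>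
    (MvPolynomial.totalDegree_mul _ _).trans (by simp)
  refine (MvPolynomial.totalDegree_add _ _).trans (max_le (by simp) ?_)
  exact (MvPolynomial.totalDegree_add _ _).trans (max_le (h _ _) (h _ _))

/-- Integrate coefficient by coefficient: the degree bound, uniform in (s, n), leaves finitely many
monomials. -/
lemma exists_mvPolynomial_boundaryIntegral {A : Euc 2 → Euc 2 → MvPolynomial (Fin 2) ℝ} {d : ℕ}
    (hA : ∀ m, Continuous fun z : Euc 2 × Euc 2 => (A z.1 z.2).coeff m)
    (hd : ∀ s n, (A s n).totalDegree ≤ d) (K : ConvexBody (Euc 2)) :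
    ∃ P : MvPolynomial (Fin 2) ℝ, P.totalDegree ≤ d ∧ ∀ x : Fin 2 → ℝ,
      boundaryIntegral (fun s n => MvPolynomial.eval x (A s n)) K = MvPolynomial.eval x P := by
  have hfin : {m : Fin 2 →₀ ℕ | m.degree ≤ d}.Finite := Finsupp.finite_of_degree_le d
  have hmem : ∀ m, m ∈ hfin.toFinset ↔ m.degree ≤ d := by simp
  refine ⟨∑ m ∈ hfin.toFinset, MvPolynomial.monomial m
    (boundaryIntegral (fun s n => (A s n).coeff m) K), ?_, fun x => ?_⟩
  · refine MvPolynomial.totalDegree_finsetSum_le fun m hm => ?_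
    exact (MvPolynomial.totalDegree_monomial_le _ _).trans ((hmem m).1 hm)
  · have h : ∀ s n, MvPolynomial.eval x (A s n) =
        ∑ m ∈ hfin.toFinset, (∏ i ∈ m.support, x i ^ m i) * (A s n).coeff m := fun s n => by
      rw [MvPolynomial.eval_eq]
      simp only [mul_comm]
      refine Finset.sum_subset (fun m hm => (hmem m).2 ?_) fun m _ hm => ?_
      · exact (MvPolynomial.le_totalDegree hm).trans (hd s n)
      · rw [MvPolynomial.notMem_support_iff.1 hm, zero_mul]
    simp only [h]
    rw [boundaryIntegral_finset_sum _ fun m _ => continuous_const.mul (hA m), map_sum]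
    refine Finset.sum_congr rfl fun m _ => ?_
    rw [boundaryIntegral_const_mul, MvPolynomial.eval_monomial, mul_comm]
    rfl

/-- The integrand of `psi p q`, as a function of a boundary point and a normal. -/
def psiKernel (p q : ℕ) (s n : Euc 2) : ℝ := inner ℝ s n ^ p * inner ℝ s (quarterTurn n) ^ q

lemma continuous_psiKernel (p q : ℕ) :
    Continuous fun z : Euc 2 × Euc 2 => psiKernel p q z.1 z.2 := by
  have := continuous_quarterTurn
  unfold psiKernel
  fun_prop

lemma psiIntegrand_eq_normalSum (p q : ℕ) (K : ConvexBody (Euc 2)) :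
    psiIntegrand p q K = normalSum (psiKernel p q) K := rfl

lemma psi_eq_boundaryIntegral (p q : ℕ) : psi p q = boundaryIntegral (psiKernel p q) := by
  funext K
  exact setIntegral_frontier_normalSum (psiKernel p q) K

theorem isPolynomialOfDegreeLE_psi (p q : ℕ) : IsPolynomialOfDegreeLE (psi p q) (p + q) := by
  intro K
  have hq := continuous_quarterTurn
  obtain ⟨P, hP, h⟩ := exists_mvPolynomial_boundaryIntegral (d := p + q)
    -- The kernel at s + x as a polynomial in x, using that ⟨s + x, n⟩ and ⟨s + x, n'⟩ are affine in
    -- x.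
    (A := fun s n => (MvPolynomial.C (inner ℝ s n) + (MvPolynomial.C (n 0) * MvPolynomial.X 0 +
      MvPolynomial.C (n 1) * MvPolynomial.X 1)) ^ p *
      (MvPolynomial.C (inner ℝ s (quarterTurn n)) + (MvPolynomial.C (-n 1) * MvPolynomial.X 0 +
      MvPolynomial.C (n 0) * MvPolynomial.X 1)) ^ q)
    (continuous_coeff_mul
      (continuous_coeff_pow (continuous_coeff_affine (by fun_prop) (by fun_prop) (by fun_prop)) p)
      (continuous_coeff_pow (continuous_coeff_affine (by fun_prop) (by fun_prop) (by fun_prop)) q))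
    (fun s n => by
      refine (MvPolynomial.totalDegree_mul _ _).trans (add_le_add ?_ ?_)
      · exact (MvPolynomial.totalDegree_pow _ _).trans
          ((Nat.mul_le_mul_left p (totalDegree_affine_le _ _ _)).trans_eq (mul_one p))
      · exact (MvPolynomial.totalDegree_pow _ _).trans
          ((Nat.mul_le_mul_left q (totalDegree_affine_le _ _ _)).trans_eq (mul_one q))) K
  refine ⟨P, hP, fun x => ?_⟩
  rw [psi_eq_boundaryIntegral, boundaryIntegral_translateBody, ← h]
  refine boundaryIntegral_congr fun s n _ => ?_
  simp only [map_mul, map_pow, map_add, MvPolynomial.eval_C, MvPolynomial.eval_X, psiKernel,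
    inner_euc_two, PiLp.add_apply, quarterTurn_zero, quarterTurn_one]
  ring

/-! ### The leading coefficient -/

lemma Polynomial.continuous_coeff_mul {Z : Type*} [TopologicalSpace Z] {A B : Z → Polynomial ℝ}
    (hA : ∀ k, Continuous fun z => (A z).coeff k) (hB : ∀ k, Continuous fun z => (B z).coeff k)
    (k : ℕ) : Continuous fun z => (A z * B z).coeff k := by
  simp only [Polynomial.coeff_mul]
  exact continuous_finsetSum _ fun i _ => (hA _).mul (hB _)

lemma Polynomial.continuous_coeff_pow {Z : Type*} [TopologicalSpace Z] {A : Z → Polynomial ℝ}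
    (hA : ∀ k, Continuous fun z => (A z).coeff k) (j : ℕ) :
    ∀ k, Continuous fun z => (A z ^ j).coeff k := by
  induction j with
  | zero => intro k; simp only [pow_zero]; exact continuous_const
  | succ j ih => simp only [pow_succ]; exact Polynomial.continuous_coeff_mul ih hA

lemma Polynomial.continuous_coeff_affine {Z : Type*} [TopologicalSpace Z] {a b : Z → ℝ}
    (ha : Continuous a) (hb : Continuous b) (k : ℕ) :
    Continuous fun z => (Polynomial.C (a z) + Polynomial.C (b z) * Polynomial.X).coeff k := by
  simp only [Polynomial.coeff_add, Polynomial.coeff_C_mul, Polynomial.coeff_C]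
  refine Continuous.add ?_ (hb.mul continuous_const)
  split_ifs
  · exact ha
  · exact continuous_const

lemma exists_polynomial_boundaryIntegral {B : Euc 2 → Euc 2 → Polynomial ℝ} {d : ℕ}
    (hB : ∀ k, Continuous fun z : Euc 2 × Euc 2 => (B z.1 z.2).coeff k)
    (hd : ∀ s n, (B s n).natDegree ≤ d) (K : ConvexBody (Euc 2)) :
    ∃ Q : Polynomial ℝ, Q.coeff d = boundaryIntegral (fun s n => (B s n).coeff d) K ∧
      ∀ t : ℝ, boundaryIntegral (fun s n => (B s n).eval t) K = Q.eval t := by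
  refine ⟨∑ k ∈ Finset.range (d + 1), Polynomial.monomial k
    (boundaryIntegral (fun s n => (B s n).coeff k) K), ?_, fun t => ?_⟩
  · simp [Polynomial.finsetSum_coeff, Polynomial.coeff_monomial]
  · have h : ∀ s n, (B s n).eval t = ∑ k ∈ Finset.range (d + 1), t ^ k * (B s n).coeff k :=
      fun s n => by
        rw [Polynomial.eval_eq_sum_range' (Nat.lt_succ_of_le (hd s n))]
        exact Finset.sum_congr rfl fun k _ => mul_comm _ _
    simp only [h]
    rw [boundaryIntegral_finset_sum _ fun k _ => continuous_const.mul (hB k),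
      Polynomial.eval_finsetSum]
    refine Finset.sum_congr rfl fun k _ => ?_
    rw [boundaryIntegral_const_mul, Polynomial.eval_monomial, mul_comm]

lemma Polynomial.natDegree_affine_le (a b : ℝ) :
    (Polynomial.C a + Polynomial.C b * Polynomial.X).natDegree ≤ 1 := by
  rw [add_comm]; exact Polynomial.natDegree_linear_le

/-- If the degree of polynomiality is less than `p + q`, then the top degree term vanishes. -/
theorem boundaryIntegral_eq_zero_of_isPolynomialOfDegreeLE {p q m : ℕ}
    (h : IsPolynomialOfDegreeLE (psi p q) m) (hm : m < p + q) (K : ConvexBody (Euc 2))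
    (x : Euc 2) :
    boundaryIntegral (fun _ n => inner ℝ x n ^ p * inner ℝ x (quarterTurn n) ^ q) K = 0 := by
  have hq := continuous_quarterTurn
  have hl : ∀ (a b : ℝ) (k : ℕ),
      ((Polynomial.C a + Polynomial.C b * Polynomial.X) ^ k).natDegree ≤ k := fun a b k => by
    simpa using Polynomial.natDegree_pow_le_of_le k (Polynomial.natDegree_affine_le a b)
  obtain ⟨Q, hQ, hQe⟩ := exists_polynomial_boundaryIntegral (d := p + q)
    (B := fun s n => (Polynomial.C (inner ℝ s n) + Polynomial.C (inner ℝ x n) * Polynomial.X) ^ p *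
      (Polynomial.C (inner ℝ s (quarterTurn n)) +
        Polynomial.C (inner ℝ x (quarterTurn n)) * Polynomial.X) ^ q)
    (Polynomial.continuous_coeff_mul
      (Polynomial.continuous_coeff_pow
        (Polynomial.continuous_coeff_affine (by fun_prop) (by fun_prop)) p)
      (Polynomial.continuous_coeff_pow
        (Polynomial.continuous_coeff_affine (by fun_prop) (by fun_prop)) q))
    (fun s n => Polynomial.natDegree_mul_le_of_le (hl _ _ p) (hl _ _ q)) K
  obtain ⟨P, hP, hPe⟩ := h K
  -- Both polynomials in t describe ψ(K + tx): Q has the wanted integral as its coefficient of order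
  -- p + q, and P bounds the degree by m.
  have hQP : Q = MvPolynomial.aeval (fun i => Polynomial.C (x i) * Polynomial.X) P := by
    refine Polynomial.funext fun t => ?_
    have h1 := hPe (t • x)
    rw [psi_eq_boundaryIntegral, boundaryIntegral_translateBody] at h1
    rw [← hQe]
    have h2 : Polynomial.eval t
        (MvPolynomial.aeval (fun i => Polynomial.C (x i) * Polynomial.X) P) =
        MvPolynomial.eval (fun i => (t • x) i) P := by
      rw [← Polynomial.coe_evalRingHom, MvPolynomial.aeval_def, MvPolynomial.hom_eval₂,
        MvPolynomial.eval, MvPolynomial.coe_eval₂Hom]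
      congr 1
      · ext r; simp
      · funext i
        rw [Polynomial.coe_evalRingHom, Polynomial.eval_mul, Polynomial.eval_C, Polynomial.eval_X,
          PiLp.smul_apply, smul_eq_mul, mul_comm]
    rw [h2, ← h1]
    refine boundaryIntegral_congr fun s n _ => ?_
    simp only [Polynomial.eval_mul, Polynomial.eval_pow, Polynomial.eval_add, Polynomial.eval_C,
      Polynomial.eval_X, psiKernel, inner_add_left, real_inner_smul_left]
    ring
  have hdeg : Q.natDegree ≤ m := by
    rw [hQP]
    simpa using MvPolynomial.aeval_natDegree_le P hP
      (fun i => Polynomial.C (x i) * Polynomial.X) (n := 1)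
      (fun i => (Polynomial.natDegree_C_mul_le _ _).trans Polynomial.natDegree_X_le)
  rw [Polynomial.coeff_eq_zero_of_natDegree_lt (hdeg.trans_lt hm)] at hQ
  rw [hQ]
  refine boundaryIntegral_congr fun s n _ => ?_
  rw [Polynomial.coeff_mul_add_eq_of_natDegree_le (hl _ _ p) (hl _ _ q)]
  have hc : ∀ (a b : ℝ) (k : ℕ),
      ((Polynomial.C a + Polynomial.C b * Polynomial.X) ^ k).coeff k = b ^ k := fun a b k => by
    have := Polynomial.coeff_pow_of_natDegree_le (m := k) (Polynomial.natDegree_affine_le a b)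
    rw [mul_one] at this
    rw [this]
    simp
  rw [hc, hc]

/-! ### The case `p + q = 1` -/

/-- The closing condition of the surface area measure: the normals integrate to zero. -/
lemma boundaryIntegral_linear (x : Euc 2) (K : ConvexBody (Euc 2)) :
    boundaryIntegral (fun _ n => inner ℝ x n) K = 0 := by
  rcases eq_or_ne x 0 with rfl | hx
  · have := boundaryIntegral_const_mul 0 (fun _ _ => 0) K
    simpa using this
  · have hx' : ‖x‖ ≠ 0 := norm_ne_zero_iff.2 hx
    have h1 := boundaryIntegral_inner_eq_zero (φ := fun _ => 1) continuous_const K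
      (u := ‖x‖⁻¹ • x) (by rw [norm_smul, norm_inv, norm_norm, inv_mul_cancel₀ hx'])
    have h2 := boundaryIntegral_const_mul ‖x‖ (fun _ n => 1 * inner ℝ (‖x‖⁻¹ • x) n) K
    rw [h1, mul_zero] at h2
    rw [← h2]
    refine boundaryIntegral_congr fun s n _ => ?_
    rw [real_inner_smul_left]
    field_simp

/-- A kernel linear in s changes under translation by a term linear in n, which integrates to zero.
-/
lemma psi_translateBody_of_add_eq_one {p q : ℕ} (h : p + q = 1) (K : ConvexBody (Euc 2))
    (x : Euc 2) : psi p q (translateBody K x) = psi p q K := by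
  have hq := continuous_quarterTurn
  rw [psi_eq_boundaryIntegral, boundaryIntegral_translateBody]
  obtain ⟨y, hy⟩ : ∃ y : Euc 2, ∀ s n, psiKernel p q (s + x) n = psiKernel p q s n + inner ℝ y n := by
    rcases Nat.add_eq_one_iff.1 h with ⟨rfl, rfl⟩ | ⟨rfl, rfl⟩
    · refine ⟨-quarterTurn x, fun s n => ?_⟩
      simp only [psiKernel, inner_euc_two, PiLp.add_apply, PiLp.neg_apply, quarterTurn_zero,
        quarterTurn_one]
      ring
    · refine ⟨x, fun s n => ?_⟩
      simp only [psiKernel, inner_euc_two, PiLp.add_apply, quarterTurn_zero, quarterTurn_one]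
      ring
  simp only [hy]
  rw [boundaryIntegral_add (continuous_psiKernel p q) (by fun_prop), boundaryIntegral_linear,
    add_zero]

/-- ⟨s, n'⟩ = s₁n₀ - s₀n₁, and in each term the coordinate of s is transverse to the axis of the
coordinate of n, so opposite sides cancel. -/
lemma psi_zero_one (K : ConvexBody (Euc 2)) : psi 0 1 K = 0 := by
  rw [psi_eq_boundaryIntegral]
  have h1 := boundaryIntegral_inner_eq_zero (φ := id) continuous_id K (u := !₂[1, 0])
    (by rw [norm_euc_two_eq_one_iff]; simp)
  have h2 := boundaryIntegral_inner_eq_zero (φ := id) continuous_id K (u := !₂[0, 1])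
    (by rw [norm_euc_two_eq_one_iff]; simp)
  have h3 : boundaryIntegral (psiKernel 0 1) K = boundaryIntegral (fun s n =>
      id (inner ℝ s (quarterTurn !₂[1, 0])) * inner ℝ !₂[1, 0] n +
      id (inner ℝ s (quarterTurn !₂[0, 1])) * inner ℝ !₂[0, 1] n) K := by
    refine boundaryIntegral_congr fun s n _ => ?_
    simp [psiKernel, inner_euc_two]
    ring
  rw [h3, boundaryIntegral_add (by fun_prop) (by fun_prop), h1, h2, add_zero]

/-! ### A right triangle -/

/-- The triangle with vertices `(0, 0)`, `(1, 0)` and `(0, 2)`. -/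
def rightTriangle : ConvexBody (Euc 2) where
  carrier := {s | 0 ≤ s 0 ∧ 0 ≤ s 1 ∧ 2 * s 0 + s 1 ≤ 2}
  convex' := by
    rintro s ⟨h1, h2, h3⟩ t ⟨h4, h5, h6⟩ a b ha hb hab
    simp only [mem_ofPred_eq, PiLp.add_apply, PiLp.smul_apply, smul_eq_mul]
    refine ⟨by positivity, by positivity, ?_⟩
    nlinarith [mul_le_mul_of_nonneg_left h3 ha, mul_le_mul_of_nonneg_left h6 hb]
  isCompact' := by
    refine Metric.isCompact_of_isClosed_isBounded ?_ ?_
    · exact (isClosed_le (by fun_prop) (by fun_prop)).and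
        ((isClosed_le (by fun_prop) (by fun_prop)).and (isClosed_le (by fun_prop) (by fun_prop)))
    · refine isBounded_iff_forall_norm_le.2 ⟨3, ?_⟩
      rintro s ⟨h1, h2, h3⟩
      refine abs_le_of_sq_le_sq' ?_ (by norm_num) |>.2
      rw [norm_sq_euc_two]
      nlinarith
  nonempty' := ⟨0, by simp⟩

lemma mem_rightTriangle {s : Euc 2} :
    s ∈ rightTriangle ↔ 0 ≤ s 0 ∧ 0 ≤ s 1 ∧ 2 * s 0 + s 1 ≤ 2 := Iff.rfl

lemma inner_le_of_mem_outerUnitNormals_rightTriangle {s n : Euc 2}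
    (hn : n ∈ outerUnitNormals rightTriangle s) :
    (0 - s 0) * n 0 + (0 - s 1) * n 1 ≤ 0 ∧ (1 - s 0) * n 0 + (0 - s 1) * n 1 ≤ 0 ∧
      (0 - s 0) * n 0 + (2 - s 1) * n 1 ≤ 0 := by
  have h1 := hn.2 !₂[0, 0] (by rw [mem_rightTriangle]; simp)
  have h2 := hn.2 !₂[1, 0] (by rw [mem_rightTriangle]; simp)
  have h3 := hn.2 !₂[0, 2] (by rw [mem_rightTriangle]; simp)
  simp only [inner_euc_two, PiLp.sub_apply] at h1 h2 h3
  exact ⟨by simpa using h1, by simpa using h2, by simpa using h3⟩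

lemma outerUnitNormals_rightTriangle_left {s : Euc 2} (h0 : s 0 = 0) (h1 : 0 < s 1)
    (h2 : s 1 < 2) : outerUnitNormals rightTriangle s = {!₂[-1, 0]} := by
  ext n
  rw [mem_singleton_iff]
  constructor
  · intro hn
    obtain ⟨ha, hb, hc⟩ := inner_le_of_mem_outerUnitNormals_rightTriangle hn
    rw [h0] at ha hb hc
    have hn1 : n 1 = 0 := le_antisymm (by nlinarith) (by nlinarith)
    have hn0 := (norm_euc_two_eq_one_iff n).1 hn.1
    rw [hn1] at hn0 hb
    have : n 0 = -1 := by nlinarith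
    exact euc_two_ext (by simpa using this) (by simpa using hn1)
  · rintro rfl
    refine ⟨by rw [norm_euc_two_eq_one_iff]; simp, fun y hy => ?_⟩
    rw [mem_rightTriangle] at hy
    simp [inner_euc_two, h0, hy.1]

lemma outerUnitNormals_rightTriangle_bottom {s : Euc 2} (h0 : s 1 = 0) (h1 : 0 < s 0)
    (h2 : s 0 < 1) : outerUnitNormals rightTriangle s = {!₂[0, -1]} := by
  ext n
  rw [mem_singleton_iff]
  constructor
  · intro hn
    obtain ⟨ha, hb, hc⟩ := inner_le_of_mem_outerUnitNormals_rightTriangle hn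
    rw [h0] at ha hb hc
    have hn1 : n 0 = 0 := le_antisymm (by nlinarith) (by nlinarith)
    have hn0 := (norm_euc_two_eq_one_iff n).1 hn.1
    rw [hn1] at hn0 hc
    have : n 1 = -1 := by nlinarith
    exact euc_two_ext (by simpa using hn1) (by simpa using this)
  · rintro rfl
    refine ⟨by rw [norm_euc_two_eq_one_iff]; simp, fun y hy => ?_⟩
    rw [mem_rightTriangle] at hy
    simp [inner_euc_two, h0, hy.2.1]

lemma mem_outerUnitNormals_rightTriangle_hypotenuse {s n : Euc 2} (h0 : 0 < s 0) (h1 : 0 < s 1)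
    (h2 : 2 * s 0 + s 1 = 2) (hn : n ∈ outerUnitNormals rightTriangle s) : n 0 = 2 * n 1 := by
  obtain ⟨-, hb, hc⟩ := inner_le_of_mem_outerUnitNormals_rightTriangle hn
  have hs : s 1 = 2 - 2 * s 0 := by linarith
  rw [hs] at hb hc h1
  have e1 : (1 - s 0) * (n 0 - 2 * n 1) ≤ 0 := by linarith
  have e2 : 0 ≤ s 0 * (n 0 - 2 * n 1) := by linarith
  have : n 0 - 2 * n 1 = 0 := le_antisymm (by
    by_contra! h
    have := mul_pos (by linarith : 0 < 1 - s 0) h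
    linarith) (nonneg_of_mul_nonneg_right e2 h0)
  linarith

lemma segment_vertical (c : ℝ) (hc : 0 < c) :
    segment ℝ (!₂[0, 0] : Euc 2) !₂[0, c] = {s | s 0 = 0 ∧ 0 ≤ s 1 ∧ s 1 ≤ c} := by
  ext s
  constructor
  · rintro ⟨a, b, ha, hb, hab, rfl⟩
    simp only [mem_ofPred_eq, PiLp.add_apply, PiLp.smul_apply]
    simp
    exact ⟨by positivity, by nlinarith⟩
  · rintro ⟨h0, h1, h2⟩
    refine ⟨1 - s 1 / c, s 1 / c, ?_, by positivity, by ring, ?_⟩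
    · rw [sub_nonneg, div_le_one hc]; exact h2
    · refine euc_two_ext ?_ ?_ <;> simp [h0, hc.ne']

lemma segment_horizontal (c : ℝ) (hc : 0 < c) :
    segment ℝ (!₂[0, 0] : Euc 2) !₂[c, 0] = {s | s 1 = 0 ∧ 0 ≤ s 0 ∧ s 0 ≤ c} := by
  ext s
  constructor
  · rintro ⟨a, b, ha, hb, hab, rfl⟩
    simp only [mem_ofPred_eq, PiLp.add_apply, PiLp.smul_apply]
    simp
    exact ⟨by positivity, by nlinarith⟩
  · rintro ⟨h0, h1, h2⟩
    refine ⟨1 - s 0 / c, s 0 / c, ?_, by positivity, by ring, ?_⟩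
    · rw [sub_nonneg, div_le_one hc]; exact h2
    · refine euc_two_ext ?_ ?_ <;> simp [h0, hc.ne']

lemma norm_vertical (c : ℝ) (hc : 0 < c) : ‖(!₂[0, c] : Euc 2)‖ = c := by
  rw [← sq_eq_sq₀ (norm_nonneg _) hc.le, norm_sq_euc_two]; simp

lemma norm_horizontal (c : ℝ) (hc : 0 < c) : ‖(!₂[c, 0] : Euc 2)‖ = c := by
  rw [← sq_eq_sq₀ (norm_nonneg _) hc.le, norm_sq_euc_two]; simp

lemma euc_two_zero : (!₂[0, 0] : Euc 2) = 0 := euc_two_ext (by simp) (by simp)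

lemma measurableSet_segment (x y : Euc 2) : MeasurableSet (segment ℝ x y) := by
  rw [segment_eq_image]
  exact (isCompact_Icc.image (by fun_prop)).measurableSet

lemma integrable_indicator_segment (x y : Euc 2) (c : ℝ) :
    Integrable ((segment ℝ x y).indicator fun _ => c) (Measure.hausdorffMeasure 1) := by
  have hm := measurableSet_segment x y
  refine (integrable_indicator_iff hm).2 (integrableOn_const ?_)
  rw [hausdorffMeasure_segment]
  exact edist_ne_top _ _

lemma integral_indicator_segment (x y : Euc 2) (c : ℝ) :
    ∫ s, (segment ℝ x y).indicator (fun _ => c) s ∂Measure.hausdorffMeasure 1 = dist x y * c := by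
  have hm := measurableSet_segment x y
  rw [integral_indicator hm, setIntegral_const, Measure.real, hausdorffMeasure_segment, edist_dist,
    ENNReal.toReal_ofReal dist_nonneg, smul_eq_mul]

/-- The integral of a function of the normal vanishing on the normal of the hypotenuse. -/
theorem boundaryIntegral_rightTriangle {f : Euc 2 → ℝ} (hf : ∀ n : Euc 2, n 0 = 2 * n 1 → f n = 0) :
    boundaryIntegral (fun _ n => f n) rightTriangle = 2 * f !₂[-1, 0] + f !₂[0, -1] := by
  have hv : ∀ᵐ s ∂(Measure.hausdorffMeasure 1 : Measure (Euc 2)),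
      s ∉ ({!₂[0, 0], !₂[1, 0], !₂[0, 2]} : Set (Euc 2)) := by
    have := Measure.nullSingletonClass_hausdorff (Euc 2) one_pos
    exact measure_eq_zero_iff_ae_notMem.1 ((Set.toFinite _).measure_zero _)
  have key : (rightTriangle : Set (Euc 2)).indicator (normalSum (fun _ n => f n) rightTriangle)
      =ᵐ[Measure.hausdorffMeasure 1] fun s =>
      (segment ℝ (!₂[0, 0] : Euc 2) !₂[0, 2]).indicator (fun _ => f !₂[-1, 0]) s +
      (segment ℝ (!₂[0, 0] : Euc 2) !₂[1, 0]).indicator (fun _ => f !₂[0, -1]) s := by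
    filter_upwards [hv] with s hs
    rw [segment_vertical 2 two_pos, segment_horizontal 1 one_pos]
    simp only [mem_insert_iff, mem_singleton_iff, not_or] at hs
    obtain ⟨hv1, hv2, hv3⟩ := hs
    have hv1' : ¬(s 0 = 0 ∧ s 1 = 0) := fun h => hv1 (euc_two_ext (by simp [h.1]) (by simp [h.2]))
    have hv2' : ¬(s 0 = 1 ∧ s 1 = 0) := fun h => hv2 (euc_two_ext (by simp [h.1]) (by simp [h.2]))
    have hv3' : ¬(s 0 = 0 ∧ s 1 = 2) := fun h => hv3 (euc_two_ext (by simp [h.1]) (by simp [h.2]))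
    by_cases hsT : s ∈ (rightTriangle : Set (Euc 2))
    · obtain ⟨h0, h1, h2⟩ := mem_rightTriangle.1 hsT
      rw [indicator_of_mem hsT]
      rcases h0.eq_or_lt with h0' | h0'
      · have h1' : 0 < s 1 := lt_of_le_of_ne h1 fun h => hv1' ⟨h0'.symm, h.symm⟩
        have h2' : s 1 < 2 := lt_of_le_of_ne (by linarith) fun h => hv3' ⟨h0'.symm, h⟩
        rw [indicator_of_mem (show s ∈ {s : Euc 2 | s 0 = 0 ∧ 0 ≤ s 1 ∧ s 1 ≤ 2} from
          ⟨h0'.symm, h1, h2'.le⟩),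
          indicator_of_notMem fun h => h1'.ne' h.1, normalSum,
          outerUnitNormals_rightTriangle_left h0'.symm h1' h2', finsum_mem_singleton, add_zero]
      · rw [indicator_of_notMem (fun h => h0'.ne' h.1), zero_add]
        rcases h1.eq_or_lt with h1' | h1'
        · have h2' : s 0 < 1 := lt_of_le_of_ne (by linarith) fun h => hv2' ⟨h, h1'.symm⟩
          rw [indicator_of_mem (show s ∈ {s : Euc 2 | s 1 = 0 ∧ 0 ≤ s 0 ∧ s 0 ≤ 1} from
            ⟨h1'.symm, h0, h2'.le⟩), normalSum,
            outerUnitNormals_rightTriangle_bottom h1'.symm h0' h2', finsum_mem_singleton]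
        · rw [indicator_of_notMem fun h => h1'.ne' h.1]
          rcases h2.eq_or_lt with h2' | h2'
          · exact finsum_mem_eq_zero_of_forall_eq_zero fun n hn =>
              hf n (mem_outerUnitNormals_rightTriangle_hypotenuse h0' h1' h2' hn)
          · refine normalSum_eq_zero_of_mem_interior _ (mem_interior.2
              ⟨{s : Euc 2 | 0 < s 0 ∧ 0 < s 1 ∧ 2 * s 0 + s 1 < 2}, ?_, ?_, h0', h1', h2'⟩)
            · rintro t ⟨ht0, ht1, ht2⟩
              exact ⟨ht0.le, ht1.le, ht2.le⟩
            · exact (isOpen_lt (by fun_prop) (by fun_prop)).and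
                ((isOpen_lt (by fun_prop) (by fun_prop)).and
                (isOpen_lt (by fun_prop) (by fun_prop)))
    · rw [indicator_of_notMem hsT, indicator_of_notMem, indicator_of_notMem, add_zero]
      · rintro ⟨h0, h1, h2⟩
        exact hsT (mem_rightTriangle.2 ⟨h1, h0.ge, by linarith⟩)
      · rintro ⟨h0, h1, h2⟩
        exact hsT (mem_rightTriangle.2 ⟨h0.ge, h1, by linarith⟩)
  rw [boundaryIntegral, ← integral_indicator rightTriangle.isClosed.measurableSet,
    integral_congr_ae key, integral_add (integrable_indicator_segment _ _ _)
      (integrable_indicator_segment _ _ _), integral_indicator_segment,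
    integral_indicator_segment, euc_two_zero, dist_zero_left, dist_zero_left,
    norm_vertical 2 two_pos, norm_horizontal 1 one_pos, one_mul]

lemma neg_one_pow_mul_add_ne_zero {a b : ℝ} (ha : 0 < a) (hb : 0 < b) (hab : a ≠ b) (i j : ℕ) :
    (-1) ^ i * a + (-1) ^ j * b ≠ 0 := by
  intro h
  rcases neg_one_pow_eq_or ℝ i with hi | hi <;> rcases neg_one_pow_eq_or ℝ j with hj | hj <;>
    rw [hi, hj] at h <;> first | linarith | exact hab (by linarith)

/-- Choose x so that one of ⟨x, n⟩, ⟨x, n'⟩ vanishes on the hypotenuse; only the legs contribute.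
With x = (2, 1) the two terms are ±2^(p+1) and ±2^q, with x = (1, -2) they are ±2^(q+1) and ±2^p.
Cancellation needs q = p + 1 or p = q + 1 respectively, and the factor that kills the hypotenuse
needs a positive exponent, which dictates the case split. -/
theorem exists_boundaryIntegral_ne_zero {p q : ℕ} (h : 2 ≤ p + q) :
    ∃ (K : ConvexBody (Euc 2)) (x : Euc 2),
      boundaryIntegral (fun _ n => inner ℝ x n ^ p * inner ℝ x (quarterTurn n) ^ q) K ≠ 0 := by
  have hpow : ∀ {i j : ℕ}, i ≠ j → (2 : ℝ) ^ i ≠ 2 ^ j := fun hij h =>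
    hij (pow_right_injective₀ two_pos (by norm_num) h)
  by_cases hpq : p = q + 1 ∨ p = 0
  · have hq : q ≠ 0 := by omega
    refine ⟨rightTriangle, !₂[2, 1], ?_⟩
    rw [boundaryIntegral_rightTriangle fun n hn => ?_]
    · have := neg_one_pow_mul_add_ne_zero (a := 2 ^ (p + 1)) (b := 2 ^ q) (by positivity)
        (by positivity) (hpow (by omega)) (p + q) p
      simp only [inner_euc_two, quarterTurn_zero, quarterTurn_one]
      convert this using 1
      simp
      rw [neg_pow 2 p]
      ring
    · simp only [inner_euc_two, quarterTurn_zero, quarterTurn_one]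
      simp [hn, hq]
  · have hp : p ≠ 0 := by omega
    refine ⟨rightTriangle, !₂[1, -2], ?_⟩
    rw [boundaryIntegral_rightTriangle fun n hn => ?_]
    · have := neg_one_pow_mul_add_ne_zero (a := 2 ^ (q + 1)) (b := 2 ^ p) (by positivity)
        (by positivity) (hpow (by omega)) p 0
      simp only [inner_euc_two, quarterTurn_zero, quarterTurn_one]
      convert this using 1
      simp
      ring
    · simp only [inner_euc_two, quarterTurn_zero, quarterTurn_one]
      simp [hn, hp]

/-! ### The main theorem -/

theorem hasPolynomialDegree_psi (p q : ℕ) :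
    HasPolynomialDegree (psi p q) (if p + q = 1 then 0 else p + q) := by
  split_ifs with h
  · refine ⟨fun K => ⟨MvPolynomial.C (psi p q K), by simp, fun x => ?_⟩, fun m _ => Nat.zero_le m⟩
    rw [psi_translateBody_of_add_eq_one h, MvPolynomial.eval_C]
  · refine ⟨isPolynomialOfDegreeLE_psi p q, fun m hm => ?_⟩
    by_contra! hlt
    obtain ⟨K, x, hx⟩ := exists_boundaryIntegral_ne_zero (p := p) (q := q) (by omega)
    exact hx (boundaryIntegral_eq_zero_of_isPolynomialOfDegreeLE hm hlt K x)

theorem psi_rotateBody (p q : ℕ) (U : Euc 2 ≃ₗᵢ[ℝ] Euc 2) (K : ConvexBody (Euc 2)) :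
    psi p q (rotateBody U K) =
      LinearMap.det (U.toLinearEquiv : Euc 2 →ₗ[ℝ] Euc 2) ^ q * psi p q K := by
  rw [psi_eq_boundaryIntegral, boundaryIntegral_rotateBody, ← boundaryIntegral_const_mul]
  refine boundaryIntegral_congr fun s n _ => ?_
  rw [psiKernel, psiKernel, quarterTurn_linearIsometry, inner_smul_right, U.inner_map_map,
    U.inner_map_map, mul_pow]
  ring

/-- The reflection in the first coordinate axis. -/
def axisReflection : Euc 2 ≃ₗᵢ[ℝ] Euc 2 where
  toFun x := !₂[x 0, -x 1]
  invFun x := !₂[x 0, -x 1]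
  map_add' x y := euc_two_ext (by simp) (by simp [add_comm])
  map_smul' c x := euc_two_ext (by simp) (by simp)
  left_inv x := euc_two_ext (by simp) (by simp)
  right_inv x := euc_two_ext (by simp) (by simp)
  norm_map' x := by
    rw [← sq_eq_sq₀ (norm_nonneg _) (norm_nonneg _), norm_sq_euc_two, norm_sq_euc_two]
    simp

lemma det_axisReflection :
    LinearMap.det (axisReflection.toLinearEquiv : Euc 2 →ₗ[ℝ] Euc 2) = -1 := by
  rw [det_euc_two]
  simp [axisReflection]

theorem isOInvariant_psi_iff (p q : ℕ) :
    IsOInvariant (psi p q) ↔ (Even q ∨ (p = 0 ∧ q = 1)) := by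
  constructor
  · intro h
    by_contra! hcon
    obtain ⟨hodd, hne⟩ := hcon
    rw [Nat.not_even_iff_odd] at hodd
    -- For odd q a reflection changes the sign of ψ, so invariance forces ψ = 0, of degree 0; this
    -- contradicts the nonzero leading coefficient.
    have hzero : ∀ K, psi p q K = 0 := fun K => by
      have h1 := h axisReflection K
      rw [psi_rotateBody, det_axisReflection, hodd.neg_one_pow] at h1
      linarith
    have hdeg : IsPolynomialOfDegreeLE (psi p q) 0 := fun K => ⟨0, by simp, fun x => by simp [hzero]⟩
    have hpq : 2 ≤ p + q := by
      obtain ⟨k, rfl⟩ := hodd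
      by_contra! hlt
      exact hne (by omega) (by omega)
    obtain ⟨K, x, hx⟩ := exists_boundaryIntegral_ne_zero hpq
    exact hx (boundaryIntegral_eq_zero_of_isPolynomialOfDegreeLE hdeg (by omega) K x)
  · rintro (⟨k, rfl⟩ | ⟨rfl, rfl⟩) U K
    · rw [psi_rotateBody, ← two_mul, pow_mul, det_linearIsometry_sq, one_pow, one_mul]
    · rw [psi_zero_one, psi_zero_one]

end

theorem proposition4p3 (p q : ℕ) :
    (∀ K : ConvexBody (Euc 2),
      IntegrableOn (psiIntegrand p q K) (frontier (K : Set (Euc 2))) (Measure.hausdorffMeasure 1)) ∧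
    Continuous (psi p q) ∧
    IsValuation (psi p q) ∧
    IsSOInvariant (psi p q) ∧
    HasPolynomialDegree (psi p q) (if p + q = 1 then 0 else p + q) ∧
    (IsOInvariant (psi p q) ↔ (Even q ∨ (p = 0 ∧ q = 1))) := by
  refine ⟨fun K => ?_, ?_, ?_, fun U hU K => ?_, hasPolynomialDegree_psi p q,
    isOInvariant_psi_iff p q⟩
  · rw [psiIntegrand_eq_normalSum]
    exact (integrableOn_normalSum (continuous_psiKernel p q) K).mono_set
      K.isClosed.frontier_subset
  · rw [psi_eq_boundaryIntegral]
    exact continuous_boundaryIntegral (continuous_psiKernel p q)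
  · rw [psi_eq_boundaryIntegral]
    exact isValuation_boundaryIntegral (continuous_psiKernel p q)
  · rw [psi_rotateBody, hU, one_pow, one_mul]
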